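/- Let $K=\mathbb{R}$ or $K=\mathbb{C}$, let $n\ge 2$, and let $e_{k,\ell}$ be the $2n\times 2n$ matrix units. Let $L_1,\dots,L_n$ be the coordinate functionals on the Lie algebra of $D_+=\{\mathrm{diag}(e^{t_1},\dots,e^{t_n},e^{-t_1},\dots,e^{-t_n}) : t_i\in\mathbb{R}\}$, and let $\Phi=\{\pm L_i\pm L_j : 1\le i,j\le n\}\setminus\{0\}$ be the root system of $SL(2n,K)$ with respect to $D_+$. For $a=(t_1,t_2)\in K^2$ put $$f_{L_i-L_j}(a)=t_1e_{i,j}+t_2e_{j+n,i+n}\ (i\ne j),\qquad f_{L_i+L_j}(a)=t_1e_{i,j+n}+t_2e_{j,i+n}\ (i<j),\qquad f_{-L_i-L_j}(a)=t_1e_{j+n,i}+t_2e_{i+n,j}\ (i<j),$$ and for $a=(t,0)$ with $t\in K$ (identified with $t$) put $f_{2L_i}(a)=te_{i,i+n}$, $f_{-2L_i}(a)=te_{i+n,i}$. Let $x_r(a)=\exp f_r(a)\in SL(2n,K)$; the parameters $a$ of the root $r$ run over $K^2$ if $r=\pm L_i\pm L_j$ with $i\ne j$, and over $K=\{(t,0)\}$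 if $r=\pm2L_i$. Write $[x,y]=xyx^{-1}y^{-1}$. (1) There are unique functions $g_{r,p,q}$, for $r,p\in\Phi$ with $r+p\neq0$ and $q\in\Phi$ of the form $q=ir+jp$ with integers $i,j>0$, assigning to parameters $a$ of $r$ and $b$ of $p$ a parameter $g_{r,p,q}(a,b)$ of $q$, such that in $SL(2n,K)$ $$[x_r(a),x_p(b)]=\prod_{q=ir+jp\in\Phi,\ i,j>0}x_q\bigl(g_{r,p,q}(a,b)\bigr)\qquad(r+p\ne0),$$ and they do not depend on the order of the factors; below, any fixed order may be chosen for each pair $r,p$. (2) $SL(2n,K)$ is presented by the generators $x_r(a)$ ($r\in\Phi$, $a$ a parameter of $r$) and the relations (i) $x_r(a)x_r(b)=x_r(a+b)$; (ii) $[x_r(a),x_p(b)]=\prod_{q=ir+jp\in\Phi,\ i,j>0}x_q(g_{r,p,q}(a,b))$ for $r+p\neq0$; (iii) $[x_r(a),x_p(b)]=1$ for $0\ne r+p\notin\Phi$; (iv) $h_{L_1-L_2}(t_1,0)\,h_{L_1-L_2}(t_2,0)=h_{L_1-L_2}(t_1t_2,0)$ for $t_1,t_2\in K^*$, where $$h_{L_1-L_2}(t,0)=x_{L_1-L_2}(t,0)\,x_{L_2-L_1}(-t^{-1},0)\,x_{L_1-L_2}(t,0)\,x_{L_1-L_2}(-1,0)\,x_{L_2-L_1}(1,0)\,x_{L_1-L_2}(-1,0).$$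 (3) Let $\widetilde G$ be the group with the same generators, written $\tilde x_r(a)$, and with only the relations (i)-(iii), and let $\pi_1:\widetilde G\to SL(2n,K)$ be the homomorphism with $\tilde x_r(a)\mapsto x_r(a)$. For a nonzero parameter $a$ of $r$ let $\tilde w_r(a)=\tilde x_r(a)\tilde x_{-r}(-a^{-1})\tilde x_r(a)$ and $\tilde h_r(a)=\tilde w_r(a)\tilde w_r(-\epsilon(a))$, where $a^{-1}$ is obtained by inverting the nonzero coordinates of $a$, and $\epsilon(a)$ by replacing them by $1$. Let $\widetilde H$ be the subgroup of $\widetilde G$ generated by all $\tilde h_r(a)$, $r\in\Phi$, $a\neq0$. Then $\pi_1$ is surjective, $\ker\pi_1\subseteq\widetilde H$, and $\ker\pi_1$ is the subgroup generated by the symbols $$\{t_1,t_2\}=\tilde h_{L_1-L_2}(t_1,0)\,\tilde h_{L_1-L_2}(t_2,0)\,\tilde h_{L_1-L_2}(t_1t_2,0)^{-1},\qquad t_1,t_2\in K^*.$$ -/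

import Mathlib

noncomputable section

namespace SLRel

open scoped commutatorElement

/-- The root system `Φ = {± L_i ± L_j} \ {0}` relative to the torus `D₊`, listed without
repetition: `L_i - L_j` (`i ≠ j`), `L_i + L_j` and `-L_i - L_j` (`i < j`), `2 L_i`, `-2 L_i`. -/
inductive Root (n : ℕ) : Type
  | sub (i j : Fin n) (h : i ≠ j) : Root n
  | add (i j : Fin n) (h : i < j) : Root n
  | negAdd (i j : Fin n) (h : i < j) : Root n
  | long (i : Fin n) : Root n
  | negLong (i : Fin n) : Root n

/-- The coordinate functional `L_i`, as an element of the character lattice `ℤⁿ`. -/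
def L {n : ℕ} (i : Fin n) : Fin n → ℤ := Pi.single i 1

/-- The linear functional on the Lie algebra of `D₊` that a root stands for. -/
def Root.wt {n : ℕ} : Root n → (Fin n → ℤ)
  | .sub i j _ => L i - L j
  | .add i j _ => L i + L j
  | .negAdd i j _ => -L i - L j
  | .long i => 2 • L i
  | .negLong i => -(2 • L i)

/-- The opposite root. -/
def Root.neg {n : ℕ} : Root n → Root n
  | .sub i j h => .sub j i h.symm
  | .add i j h => .negAdd i j h
  | .negAdd i j h => .add i j h
  | .long i => .negLong i
  | .negLong i => .long i

theorem Root.wt_neg {n : ℕ} (r : Root n) : r.neg.wt = -r.wt := by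
  cases r <;> simp [Root.neg, Root.wt] <;> abel

/-- The parameters of the root subgroup of `r`: all of `K²` if `r = ± L_i ± L_j` with `i ≠ j`,
and `K`, embedded in `K²` as `{(t, 0)}`, if `r = ± 2 L_i`. -/
def Root.params (K : Type*) [Field K] {n : ℕ} : Root n → AddSubgroup (K × K)
  | .long _ => AddSubgroup.prod ⊤ ⊥
  | .negLong _ => AddSubgroup.prod ⊤ ⊥
  | _ => ⊤

theorem Root.params_neg (K : Type*) [Field K] {n : ℕ} (r : Root n) :
    r.neg.params K = r.params K := by
  cases r <;> rfl

/-- The root vector `f_r(t₁, t₂)`. Rows and columns are indexed by `Fin n ⊕ Fin n`: the index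
`i ≤ n` is `Sum.inl i` and the index `i + n` is `Sum.inr i`. -/
def rootVec {K : Type*} [Field K] {n : ℕ} :
    Root n → K × K → Matrix (Fin n ⊕ Fin n) (Fin n ⊕ Fin n) K
  | .sub i j _, t => Matrix.single (.inl i) (.inl j) t.1 + Matrix.single (.inr j) (.inr i) t.2
  | .add i j _, t => Matrix.single (.inl i) (.inr j) t.1 + Matrix.single (.inl j) (.inr i) t.2
  | .negAdd i j _, t => Matrix.single (.inr j) (.inl i) t.1 + Matrix.single (.inr i) (.inl j) t.2
  | .long i, t => Matrix.single (.inl i) (.inr i) t.1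
  | .negLong i, t => Matrix.single (.inr i) (.inl i) t.1

theorem rootVec_mul_self {K : Type*} [Field K] {n : ℕ} (r : Root n) (t : K × K) :
    rootVec r t * rootVec r t = 0 := by
  cases r with
  | sub i j h => simp [rootVec, mul_add, add_mul, h, h.symm]
  | _ => simp [rootVec, mul_add, add_mul]

theorem det_one_add_rootVec {K : Type*} [Field K] {n : ℕ} (r : Root n) (t : K × K) :
    (1 + rootVec r t).det = 1 := by
  have key : ∀ (a b c d : Fin n ⊕ Fin n) (x y : K), a ≠ b → c ≠ d → b ≠ c →
      (1 + (Matrix.single a b x + Matrix.single c d y)).det = 1 := by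
    intro a b c d x y hab hcd hbc
    have e : 1 + (Matrix.single a b x + Matrix.single c d y)
        = Matrix.transvection a b x * Matrix.transvection c d y := by
      simp [Matrix.transvection, mul_add, add_mul, hbc, add_assoc]
    rw [e, Matrix.det_mul, Matrix.det_transvection_of_ne a b hab,
      Matrix.det_transvection_of_ne c d hcd, one_mul]
  cases r with
  | sub i j h => exact key _ _ _ _ _ _ (by simpa using h) (by simpa using h.symm) (by simp)
  | add i j h => exact key _ _ _ _ _ _ (by simp) (by simp) (by simp)
  | negAdd i j h => exact key _ _ _ _ _ _ (by simp) (by simp) (by simp)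
  | long i => exact Matrix.det_transvection_of_ne _ _ (by simp) _
  | negLong i => exact Matrix.det_transvection_of_ne _ _ (by simp) _

theorem exp_rootVec {K : Type*} [RCLike K] {n : ℕ} (r : Root n) (t : K × K) :
    NormedSpace.exp (rootVec r t) = 1 + rootVec r t := by
  rw [NormedSpace.exp_eq_tsum K]
  have h : ∀ m ∉ Finset.range 2,
      ((Nat.factorial m : K)⁻¹) • (rootVec r t) ^ m = 0 := by
    intro m hm
    have hm2 : 2 ≤ m := not_lt.mp fun h => hm (Finset.mem_range.mpr h)
    obtain ⟨k, rfl⟩ := Nat.exists_eq_add_of_le hm2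
    rw [pow_add, pow_two, rootVec_mul_self, zero_mul, smul_zero]
  show (∑' m : ℕ, ((Nat.factorial m : K)⁻¹) • (rootVec r t) ^ m) = _
  rw [tsum_eq_sum h]
  simp [Finset.sum_range_succ]

/-- The element `x_r(a) = exp (f_r(a))` of `SL(2n, K)`. -/
def rootElt {K : Type*} [RCLike K] {n : ℕ} (r : Root n) (a : r.params K) :
    Matrix.SpecialLinearGroup (Fin n ⊕ Fin n) K :=
  ⟨NormedSpace.exp (rootVec r a.1), by rw [exp_rootVec, det_one_add_rootVec]⟩

/-- The roots of the form `i r + j p` with integers `i, j > 0`. -/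
abbrev Comb {n : ℕ} (r p : Root n) : Type :=
  {q : Root n // ∃ i j : ℕ, 0 < i ∧ 0 < j ∧ q.wt = i • r.wt + j • p.wt}

/-- A choice, for each pair `r, p` of roots, of the order of the factors in a product over all
roots of the form `i r + j p`, `i, j > 0`. -/
structure FactorOrder (n : ℕ) where
  list : ∀ r p : Root n, List (Comb r p)
  nodup : ∀ r p, (list r p).Nodup
  complete : ∀ r p q, q ∈ list r p

/-- Families of functions `g` with `g r p q (a, b)` a parameter for the root `q`, for all roots
`r, p` with `r + p ≠ 0`, all roots `q` of the form `i r + j p`, `i, j > 0`, and all parameters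
`a` of `r` and `b` of `p`. -/
abbrev CommFun (n : ℕ) (K : Type*) [Field K] : Type _ :=
  ∀ r p : Root n, r.wt + p.wt ≠ 0 → ∀ q : Comb r p, r.params K → p.params K → q.1.params K

/-- The commutator formula
`[x_r(a), x_p(b)] = ∏ x_q(g r p q (a, b))`, over all `q = i r + j p` with `i, j > 0`,
holds in `SL(2n, K)` for all roots `r, p` with `r + p ≠ 0`. -/
def CommFormula {n : ℕ} {K : Type*} [RCLike K] (ord : FactorOrder n) (g : CommFun n K) : Prop :=
  ∀ (r p : Root n) (h : r.wt + p.wt ≠ 0) (a : r.params K) (b : p.params K),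
    ⁅rootElt r a, rootElt p b⁆ =
      ((ord.list r p).map fun q => rootElt q.1 (g r p h q a b)).prod

/-- The abstract generators: one symbol `x_r(a)` for each root `r` and each parameter `a`. -/
abbrev Gen (n : ℕ) (K : Type*) [Field K] : Type _ := Σ r : Root n, r.params K

/-- The generator `x_r(a)` in the free group. -/
def X {n : ℕ} {K : Type*} [Field K] (r : Root n) (a : r.params K) : FreeGroup (Gen n K) :=
  FreeGroup.of ⟨r, a⟩

/-- Relators for additivity, `x_r(a) x_r(b) = x_r(a + b)`. -/
def addRels (n : ℕ) (K : Type*) [Field K] : Set (FreeGroup (Gen n K)) :=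
  {w | ∃ (r : Root n) (a b : r.params K), w = X r a * X r b * (X r (a + b))⁻¹}

/-- Relators for the commutator formulas, for `r + p ≠ 0`. -/
def commRels {n : ℕ} {K : Type*} [Field K] (ord : FactorOrder n) (g : CommFun n K) :
    Set (FreeGroup (Gen n K)) :=
  {w | ∃ (r p : Root n) (h : r.wt + p.wt ≠ 0) (a : r.params K) (b : p.params K),
    w = ⁅X r a, X p b⁆ * (((ord.list r p).map fun q => X q.1 (g r p h q a b)).prod)⁻¹}

/-- Relators `[x_r(a), x_p(b)]` for `0 ≠ r + p ∉ Φ`. -/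
def trivialCommRels (n : ℕ) (K : Type*) [Field K] : Set (FreeGroup (Gen n K)) :=
  {w | ∃ (r p : Root n) (a : r.params K) (b : p.params K),
    r.wt + p.wt ≠ 0 ∧ (∀ q : Root n, q.wt ≠ r.wt + p.wt) ∧ w = ⁅X r a, X p b⁆}

/-- The group `G̃`, defined by the additivity and the commutator relations only. -/
abbrev GTilde {n : ℕ} {K : Type*} [Field K] (ord : FactorOrder n) (g : CommFun n K) : Type _ :=
  PresentedGroup (addRels n K ∪ commRels ord g ∪ trivialCommRels n K)

/-- The root `L_1 - L_2`. -/
def root12 {n : ℕ} (hn : 2 ≤ n) : Root n :=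
  .sub ⟨0, by omega⟩ ⟨1, by omega⟩ (by simp)

/-- The parameter `(t, 0)` of `L_1 - L_2`. -/
def par {n : ℕ} {K : Type*} [Field K] (hn : 2 ≤ n) (t : K) : (root12 hn).params K :=
  ⟨(t, 0), AddSubgroup.mem_top _⟩

/-- The parameter `(t, 0)` of `L_2 - L_1`. -/
def par' {n : ℕ} {K : Type*} [Field K] (hn : 2 ≤ n) (t : K) : (root12 hn).neg.params K :=
  ⟨(t, 0), AddSubgroup.mem_top _⟩

/-- The word `h_{L_1-L_2}(t, 0)`, equal to
`x_{L_1-L_2}(t,0) x_{L_2-L_1}(-t⁻¹,0) x_{L_1-L_2}(t,0) x_{L_1-L_2}(-1,0) x_{L_2-L_1}(1,0)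
x_{L_1-L_2}(-1,0)`. -/
def h12 {n : ℕ} {K : Type*} [Field K] (hn : 2 ≤ n) (t : Kˣ) : FreeGroup (Gen n K) :=
  X (root12 hn) (par hn (t : K)) * X (root12 hn).neg (par' hn (-(t : K)⁻¹)) *
    X (root12 hn) (par hn (t : K)) *
  (X (root12 hn) (par hn (-1)) * X (root12 hn).neg (par' hn 1) * X (root12 hn) (par hn (-1)))

/-- Relators for multiplicativity, `h_{L_1-L_2}(t₁,0) h_{L_1-L_2}(t₂,0) = h_{L_1-L_2}(t₁t₂,0)`. -/
def multRels {n : ℕ} (K : Type*) [Field K] (hn : 2 ≤ n) : Set (FreeGroup (Gen n K)) :=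
  {w | ∃ t₁ t₂ : Kˣ, w = h12 hn t₁ * h12 hn t₂ * (h12 hn (t₁ * t₂))⁻¹}

theorem neg_inv_mem {n : ℕ} {K : Type*} [Field K] (r : Root n) (a : r.params K) :
    -(a.1⁻¹) ∈ r.neg.params K := by
  rw [Root.params_neg]
  obtain ⟨a, ha⟩ := a
  cases r <;> simp [Root.params, AddSubgroup.mem_prod] at ha ⊢ <;> simp [ha]

/-- The word `w_r(a) = x_r(a) x_{-r}(-a⁻¹) x_r(a)`. The inverse is taken in each coordinate, with
`0⁻¹ = 0`; so `w_r(t, 0) = x_r(t, 0) x_{-r}(-t⁻¹, 0) x_r(t, 0)` and so on. -/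
def wWord {n : ℕ} {K : Type*} [Field K] (r : Root n) (a : r.params K) : FreeGroup (Gen n K) :=
  X r a * X r.neg ⟨-(a.1⁻¹), neg_inv_mem r a⟩ * X r a

theorem neg_sign_mem {n : ℕ} {K : Type*} [Field K] (r : Root n) (a : r.params K) :
    -(a.1 * a.1⁻¹) ∈ r.params K := by
  obtain ⟨a, ha⟩ := a
  cases r <;> simp [Root.params, AddSubgroup.mem_prod] at ha ⊢ <;> simp [ha]

/-- The word `h_r(a)`, for a nonzero parameter `a`: `h_r(t₁, t₂) = w_r(t₁, t₂) w_r(-1, -1)`,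
`h_r(t, 0) = w_r(t, 0) w_r(-1, 0)`, `h_r(0, t) = w_r(0, t) w_r(0, -1)` for `t₁, t₂, t ≠ 0`. -/
def hWord {n : ℕ} {K : Type*} [Field K] (r : Root n) (a : r.params K) : FreeGroup (Gen n K) :=
  wWord r a * wWord r ⟨-(a.1 * a.1⁻¹), neg_sign_mem r a⟩

/-- The subgroup `H̃` of `G̃`, generated by all `h_r(a)`, `r` a root and `a ≠ 0`. -/
def HTilde {n : ℕ} {K : Type*} [Field K] (ord : FactorOrder n) (g : CommFun n K) :
    Subgroup (GTilde ord g) :=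
  Subgroup.closure {x | ∃ (r : Root n) (a : r.params K), a ≠ 0 ∧
    x = PresentedGroup.mk _ (hWord r a)}

/-- The symbol `{t₁, t₂} = h_{L_1-L_2}(t₁,0) h_{L_1-L_2}(t₂,0) h_{L_1-L_2}(t₁t₂,0)⁻¹` in `G̃`. -/
def symb {n : ℕ} {K : Type*} [Field K] (hn : 2 ≤ n) (ord : FactorOrder n) (g : CommFun n K)
    (t₁ t₂ : Kˣ) : GTilde ord g :=
  PresentedGroup.mk _ (h12 hn t₁ * h12 hn t₂ * (h12 hn (t₁ * t₂))⁻¹)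

end SLRel

end

/-! The theorem reduces to the Steinberg presentation of `SL(2n, K)` on the elementary matrices `1 +
t E_ab`, `a ≠ b`.

Commutator formula. Give the entry `(a, b)` the weight `idxWt a - idxWt b`; then `f_r` is a weight
vector of weight `r`. All these differences have squared norm at most 4, whereas the sum of two
weights of the form `i r + j p` with `i, j > 0` has squared norm greater than 4 when `r + p ≠ 0`
(`Comb.norm_add_gt`). Hence `f_q f_q' = 0` for any two factors, and the product of the `x_q` is `1 +
∑ f_q` in every order. Its entries determine the parameters. Existence holds because a commutator
minus 1 is a combination of words in `f_r, f_p` whose weights are again of the form `i r + j p`.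

From roots to elementary elements. In any group satisfying the root relations, `x_r(a)` is a product
of at most two elements `e_ab(t)`. The commutator relations yield all Steinberg relations among
these, except that `e_ab` and `e_cd` commute when `c`, `d` are the partners of `a`, `b`: these lie
in opposite root groups, about which no relation is given. That case follows from the others because
2 is invertible (`commute_of_relations`).

Kernel. The symbols of one pair of indices are central and trivial in `SL`. After dividing by them
`h_ij` becomes multiplicative for all pairs, and it must be shown that the map to matrices is then
injective. This goes by induction on the set of indices (`levi_faithful`). The big cell of products
column × torus × parabolic is stable under left multiplication by row elements as long as the corner
entry stays nonzero, and its row translates cover the group. So an element of the kernel lies in the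
cell, where the column, torus and row parts can be read off from the matrix and are trivial; what
remains involves one index fewer. Surjectivity is Gaussian elimination. -/

namespace Steinberg

/-! ### Steinberg relations: Weyl elements, torus elements and symbols. -/

open scoped commutatorElement

variable {ι K G : Type*} [Field K] [Group G]

/-- A family of elements of a group that satisfies the Steinberg relations. -/
structure IsSteinberg (e : ι → ι → K → G) : Prop where
  add : ∀ {i j}, i ≠ j → ∀ s t, e i j (s + t) = e i j s * e i j t
  comm : ∀ {i j k l}, i ≠ j → k ≠ l → j ≠ k → i ≠ l → ∀ s t, Commute (e i j s) (e k l t)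
  mul : ∀ {i j k}, i ≠ j → j ≠ k → i ≠ k → ∀ s t, ⁅e i j s, e j k t⁆ = e i k (s * t)

/-- The image of a Steinberg family under the transpose-inverse symmetry. -/
def dual (e : ι → ι → K → G) : ι → ι → K → G := fun i j t => e j i (-t)

/-- The element `w_ij(u)`. -/
def w (e : ι → ι → K → G) (i j : ι) (u : K) : G := e i j u * e j i (-u⁻¹) * e i j u

/-- The element `h_ij(u)`. -/
def h (e : ι → ι → K → G) (i j : ι) (u : K) : G := w e i j u * w e i j (-1)

theorem w_dual (e : ι → ι → K → G) (i j : ι) (u : K) : w (dual e) i j (-u) = w e j i u := by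
  simp [w, dual, inv_neg]

theorem semiconjBy_commutator {g x y x' y' : G} (hx : SemiconjBy g x x') (hy : SemiconjBy g y y') :
    SemiconjBy g ⁅x, y⁆ ⁅x', y'⁆ := by
  simp only [commutatorElement_def]
  exact ((hx.mul_right hy).mul_right hx.inv_right).mul_right hy.inv_right

omit [Field K] in
theorem semiconjBy_congr {f : K → G} {g x : G} {a b : K} (H : SemiconjBy g x (f a)) (hab : a = b) :
    SemiconjBy g x (f b) := hab ▸ H

namespace IsSteinberg

variable {e : ι → ι → K → G} (he : IsSteinberg e)
include he

theorem zero {i j : ι} (hij : i ≠ j) : e i j 0 = 1 := by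
  have := he.add hij 0 0
  simpa using this

theorem neg {i j : ι} (hij : i ≠ j) (t : K) : e i j (-t) = (e i j t)⁻¹ := by
  rw [eq_inv_iff_mul_eq_one, ← he.add hij, neg_add_cancel, he.zero hij]

theorem dual : IsSteinberg (dual e) where
  add hij s t := by simp only [Steinberg.dual, neg_add]; exact he.add hij.symm _ _
  comm hij hkl hjk hil s t := he.comm hij.symm hkl.symm hil hjk _ _
  mul hij hjk hik s t := by
    simp only [Steinberg.dual]
    rw [← commutatorElement_inv, he.mul hjk.symm hij.symm hik.symm, ← he.neg hik.symm]
    congr 1; ring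

theorem mul_swap {i j k : ι} (hij : i ≠ j) (hjk : j ≠ k) (hik : i ≠ k) (s t : K) :
    e i j s * e j k t = e i k (s * t) * e j k t * e i j s := by
  rw [← he.mul hij hjk hik]; simp [commutatorElement_def, mul_assoc]

/-- Conjugation on the pair of entries `(i, l)`, `(j, l)`. -/
theorem semiconj_col {i j l : ι} (hij : i ≠ j) (hil : i ≠ l) (hjl : j ≠ l) (s x y : K) :
    SemiconjBy (e i j s) (e i l x * e j l y) (e i l (x + s * y) * e j l y) := by
  have h1 := (he.comm hij hil hij.symm hil s x).eq
  have h2 := he.mul_swap hij hjl hil s y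
  rw [SemiconjBy, he.add hil, ← mul_assoc, h1, mul_assoc, h2]
  simp only [mul_assoc]

theorem semiconj_col' {i j l : ι} (hij : i ≠ j) (hil : i ≠ l) (hjl : j ≠ l) (s x y : K) :
    SemiconjBy (e j i s) (e i l x * e j l y) (e i l x * e j l (y + s * x)) := by
  have hc := fun x y => (he.comm hil hjl hjl.symm hil x y).eq
  rw [hc, hc]
  exact he.semiconj_col hij.symm hjl hil s y x

/-- Conjugation by `e i j s` and `e j i s` acts on the pair of entries in column `l` as the
elementary 2 × 2 matrices do, so `w` acts by their product, the matrix with rows `(0, u)` and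
`(-u⁻¹, 0)`. -/
theorem w_col {i j l : ι} (hij : i ≠ j) (hil : i ≠ l) (hjl : j ≠ l) {u : K} (hu : u ≠ 0) (x y : K) :
    SemiconjBy (w e i j u) (e i l x * e j l y) (e i l (u * y) * e j l (-u⁻¹ * x)) := by
  have := ((he.semiconj_col hij hil hjl u _ _).mul_left (he.semiconj_col' hij hil hjl (-u⁻¹) _ _)
    ).mul_left (he.semiconj_col hij hil hjl u x y)
  have e1 : x + u * y + u * (y + -u⁻¹ * (x + u * y)) = u * y := by
    field_simp; ring
  have e2 : y + -u⁻¹ * (x + u * y) = -u⁻¹ * x := by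
    field_simp; ring
  rw [e1, e2] at this
  exact this

theorem w_il {i j l : ι} (hij : i ≠ j) (hil : i ≠ l) (hjl : j ≠ l) {u : K} (hu : u ≠ 0) (t : K) :
    SemiconjBy (w e i j u) (e i l t) (e j l (-u⁻¹ * t)) := by
  simpa [he.zero hil, he.zero hjl] using he.w_col hij hil hjl hu t 0

theorem w_jl {i j l : ι} (hij : i ≠ j) (hil : i ≠ l) (hjl : j ≠ l) {u : K} (hu : u ≠ 0) (t : K) :
    SemiconjBy (w e i j u) (e j l t) (e i l (u * t)) := by
  simpa [he.zero hil, he.zero hjl] using he.w_col hij hil hjl hu 0 t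

theorem w_ki {i j k : ι} (hij : i ≠ j) (hik : i ≠ k) (hjk : j ≠ k) {u : K} (hu : u ≠ 0) (t : K) :
    SemiconjBy (w e i j u) (e k i t) (e k j (-u * t)) := by
  have := he.dual.w_jl hij.symm hjk hik (neg_ne_zero.2 hu) (-t)
  rw [w_dual] at this
  simpa [Steinberg.dual] using this

theorem w_kj {i j k : ι} (hij : i ≠ j) (hik : i ≠ k) (hjk : j ≠ k) {u : K} (hu : u ≠ 0) (t : K) :
    SemiconjBy (w e i j u) (e k j t) (e k i (u⁻¹ * t)) := by
  have := he.dual.w_il hij.symm hjk hik (neg_ne_zero.2 hu) (-t)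
  rw [w_dual] at this
  simpa [Steinberg.dual, inv_neg] using this

theorem w_inv {i j : ι} (hij : i ≠ j) (u : K) : w e i j (-u) = (w e i j u)⁻¹ := by
  simp [w, inv_neg, he.neg hij, he.neg hij.symm, mul_assoc]

theorem w_comm {i j k l : ι} (hij : i ≠ j) (hkl : k ≠ l) (hki : k ≠ i) (hkj : k ≠ j)
    (hli : l ≠ i) (hlj : l ≠ j) (u t : K) : Commute (w e i j u) (e k l t) :=
  ((he.comm hij hkl hkj.symm hli.symm _ _).mul_left
    (he.comm hij.symm hkl hki.symm hlj.symm _ _)).mul_left (he.comm hij hkl hkj.symm hli.symm _ _)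

variable (hι : ∀ i j : ι, ∃ m, m ≠ i ∧ m ≠ j)
include hι

/-- No commutator relation applies to `e i j` and `e j i` directly. A third index `m` writes `e i j
t` as a commutator of entries `(i, m)` and `(m, j)`, on which the action of `w` is known. -/
theorem w_ij {i j : ι} (hij : i ≠ j) {u : K} (hu : u ≠ 0) (t : K) :
    SemiconjBy (w e i j u) (e i j t) (e j i (-u⁻¹ * u⁻¹ * t)) := by
  obtain ⟨m, hmi, hmj⟩ := hι i j
  have := semiconjBy_commutator (he.w_il hij hmi.symm hmj.symm hu t)
    (he.w_kj hij hmi.symm hmj.symm hu 1)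
  rw [he.mul hmi.symm hmj hij, he.mul hmj.symm hmi hij.symm] at this
  convert this using 2 <;> ring

theorem w_ji {i j : ι} (hij : i ≠ j) {u : K} (hu : u ≠ 0) (t : K) :
    SemiconjBy (w e i j u) (e j i t) (e i j (-u * u * t)) := by
  obtain ⟨m, hmi, hmj⟩ := hι i j
  have := semiconjBy_commutator (he.w_jl hij hmi.symm hmj.symm hu t)
    (he.w_ki hij hmi.symm hmj.symm hu 1)
  rw [he.mul hmj.symm hmi hij.symm, he.mul hmi.symm hmj hij] at this
  convert this using 2 <;> ring

/-- Conjugation by `w e i j u` fixes `w e i j u`, yet carries its three factors to those of `w e j i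
(-u⁻¹)`. -/
theorem w_swap {i j : ι} (hij : i ≠ j) {u : K} (hu : u ≠ 0) : w e j i (-u⁻¹) = w e i j u := by
  have h1 := he.w_ij hι hij hu u
  have h2 := he.w_ji hι hij hu (-u⁻¹)
  have e1 : -u⁻¹ * u⁻¹ * u = -u⁻¹ := by field_simp
  have e2 : -u * u * -u⁻¹ = -(-u⁻¹)⁻¹ := by field_simp
  rw [e1] at h1
  rw [e2] at h2
  have h3 : SemiconjBy (w e i j u) (w e i j u) (w e j i (-u⁻¹)) :=
    (h1.mul_right h2).mul_right h1
  exact (mul_right_cancel h3).symm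

end IsSteinberg

/-- The diagonal entries of the matrix of `h_ij(u)`. -/
def diagFun [DecidableEq ι] (i j : ι) (u : K) (k : ι) : K :=
  if k = i then u else if k = j then u⁻¹ else 1

theorem diagFun_ne_zero [DecidableEq ι] (i j : ι) {u : K} (hu : u ≠ 0) (k : ι) :
    diagFun i j u k ≠ 0 := by
  unfold diagFun; split_ifs <;> simp [hu]

theorem diagFun_mul [DecidableEq ι] (i j : ι) (u v : K) (k : ι) :
    diagFun i j (u * v) k = diagFun i j u k * diagFun i j v k := by
  unfold diagFun; split_ifs <;> simp [mul_comm]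

namespace IsSteinberg

variable {e : ι → ι → K → G} (he : IsSteinberg e)
include he

variable (hι : ∀ i j : ι, ∃ m, m ≠ i ∧ m ≠ j)
include hι

theorem h_semiconj [DecidableEq ι] {i j k l : ι} (hij : i ≠ j) (hkl : k ≠ l) {u : K} (hu : u ≠ 0)
    (t : K) : SemiconjBy (h e i j u) (e k l t)
      (e k l (diagFun i j u k * (diagFun i j u l)⁻¹ * t)) := by
  have h1 : (-1 : K) ≠ 0 := by simp
  by_cases hki : k = i
  · subst hki
    by_cases hlj : l = j
    · subst hlj
      refine semiconjBy_congr (f := e k l) ((he.w_ji hι hij hu _).mul_left (he.w_ij hι hij h1 t)) ?_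
      simp [diagFun, hij.symm, inv_neg]
    · refine semiconjBy_congr (f := e k l) ((he.w_jl hij hkl (Ne.symm hlj) hu _).mul_left
        (he.w_il hij hkl (Ne.symm hlj) h1 t)) ?_
      simp [diagFun, hkl.symm, hlj, inv_neg]
  by_cases hkj : k = j
  · subst hkj
    by_cases hli : l = i
    · subst hli
      refine semiconjBy_congr (f := e k l) ((he.w_ij hι hij hu _).mul_left (he.w_ji hι hij h1 t)) ?_
      simp [diagFun, hij.symm]
    · refine semiconjBy_congr (f := e k l) ((he.w_il hij (Ne.symm hli) hkl hu _).mul_left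
        (he.w_jl hij (Ne.symm hli) hkl h1 t)) ?_
      simp [diagFun, hkl.symm, hki, hli]
  by_cases hli : l = i
  · subst hli
    refine semiconjBy_congr (f := e k l) ((he.w_kj hij (Ne.symm hki) (Ne.symm hkj) hu _).mul_left
      (he.w_ki hij (Ne.symm hki) (Ne.symm hkj) h1 t)) ?_
    simp [diagFun, hki, hkj]
  by_cases hlj : l = j
  · subst hlj
    refine semiconjBy_congr (f := e k l) ((he.w_ki hij (Ne.symm hki) (Ne.symm hkj) hu _).mul_left
      (he.w_kj hij (Ne.symm hki) (Ne.symm hkj) h1 t)) ?_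
    simp [diagFun, hki, hkj, hij.symm, inv_neg]
  · have := (he.w_comm hij hkl hki hkj hli hlj u t).mul_left
      (he.w_comm hij hkl hki hkj hli hlj (-1) t)
    simp only [diagFun, hki, hkj, hli, hlj, if_false, inv_one, one_mul]
    exact this

omit hι in
theorem h_one {i j : ι} (hij : i ≠ j) : h e i j 1 = 1 := by
  rw [h, he.w_inv hij, mul_inv_cancel]

/-- The symbol `h_ij(u) h_ij(v) h_ij(uv)⁻¹` is central. -/
theorem symbol_commute {i j k l : ι} (hij : i ≠ j) (hkl : k ≠ l) {u v : K} (hu : u ≠ 0)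
    (hv : v ≠ 0) (t : K) :
    Commute (h e i j u * h e i j v * (h e i j (u * v))⁻¹) (e k l t) := by
  classical
  have h3 := he.h_semiconj hι hij hkl (mul_ne_zero hu hv)
    ((diagFun i j (u * v) k)⁻¹ * (diagFun i j (u * v) l) * t)
  have h2 := he.h_semiconj hι hij hkl hv ((diagFun i j (u * v) k)⁻¹ * (diagFun i j (u * v) l) * t)
  have h1 := (he.h_semiconj hι hij hkl hu _).mul_left h2
  have h4 := SemiconjBy.inv_symm_left h3
  have a1 := diagFun_ne_zero i j hu k
  have a2 := diagFun_ne_zero i j hu l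
  have a3 := diagFun_ne_zero i j hv k
  have a4 := diagFun_ne_zero i j hv l
  have h5 := h1.mul_left h4
  have e1 : diagFun i j (u * v) k * (diagFun i j (u * v) l)⁻¹ *
      ((diagFun i j (u * v) k)⁻¹ * diagFun i j (u * v) l * t) = t := by
    simp only [diagFun_mul]; field_simp
  have e2 : diagFun i j u k * (diagFun i j u l)⁻¹ * (diagFun i j v k * (diagFun i j v l)⁻¹ *
      ((diagFun i j (u * v) k)⁻¹ * diagFun i j (u * v) l * t)) = t := by
    simp only [diagFun_mul]; field_simp
  rw [e1, e2] at h5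
  exact h5

-- The parameter `-1` makes both constants in the action of `w` equal to 1, so conjugation relabels
-- the index `l` as `j` without changing signs.
omit hι in
theorem h_move_right {k l j : ι} (hkl : k ≠ l) (hlj : l ≠ j) (hkj : k ≠ j) (u : K) :
    SemiconjBy (w e l j (-1)) (h e k l u) (h e k j u) := by
  have h1 : (-1 : K) ≠ 0 := by simp
  have a := fun t => he.w_ki hlj hkl.symm hkj.symm h1 t
  have b := fun t => he.w_il hlj hkl.symm hkj.symm h1 t
  simp only [neg_neg, one_mul, inv_neg, inv_one] at a b
  exact (((a _).mul_right (b _)).mul_right (a _)).mul_right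
    (((a _).mul_right (b _)).mul_right (a _))

omit hι in
theorem h_move_left {k l j : ι} (hkl : k ≠ l) (hlj : l ≠ j) (hkj : k ≠ j) (u : K) :
    SemiconjBy (w e k j (-1)) (h e k l u) (h e j l u) := by
  have h1 : (-1 : K) ≠ 0 := by simp
  have a := fun t => he.w_ki hkj hkl hlj.symm h1 t
  have b := fun t => he.w_il hkj hkl hlj.symm h1 t
  simp only [neg_neg, one_mul, inv_neg, inv_one] at a b
  exact (((b _).mul_right (a _)).mul_right (b _)).mul_right
    (((b _).mul_right (a _)).mul_right (b _))

omit he hι in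
theorem mult_of_semiconj {g : G} {f f' : K → G} (hg : ∀ u, SemiconjBy g (f u) (f' u))
    (hf : ∀ u v : K, u ≠ 0 → v ≠ 0 → f u * f v = f (u * v)) (u v : K) (hu : u ≠ 0) (hv : v ≠ 0) :
    f' u * f' v = f' (u * v) := by
  have h1 := (hg u).mul_right (hg v)
  rw [hf u v hu hv] at h1
  exact mul_right_cancel (h1.eq.symm.trans (hg (u * v)).eq)

theorem h_mult {p q : ι} (hpq : p ≠ q)
    (hm : ∀ u v : K, u ≠ 0 → v ≠ 0 → h e p q u * h e p q v = h e p q (u * v))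
    {k l : ι} (hkl : k ≠ l) (u v : K) (hu : u ≠ 0) (hv : v ≠ 0) :
    h e k l u * h e k l v = h e k l (u * v) := by
  have R : ∀ {a b c : ι}, a ≠ b → a ≠ c →
      (∀ u v : K, u ≠ 0 → v ≠ 0 → h e a b u * h e a b v = h e a b (u * v)) →
      (∀ u v : K, u ≠ 0 → v ≠ 0 → h e a c u * h e a c v = h e a c (u * v)) := by
    intro a b c hab hac H
    by_cases hbc : b = c
    · exact hbc ▸ H
    · exact mult_of_semiconj (fun u => he.h_move_right hab hbc hac u) H
  have L : ∀ {a b c : ι}, a ≠ b → c ≠ b →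
      (∀ u v : K, u ≠ 0 → v ≠ 0 → h e a b u * h e a b v = h e a b (u * v)) →
      (∀ u v : K, u ≠ 0 → v ≠ 0 → h e c b u * h e c b v = h e c b (u * v)) := by
    intro a b c hab hac H
    by_cases hbc : a = c
    · exact hbc ▸ H
    · exact mult_of_semiconj (fun u => he.h_move_left hab (Ne.symm hac) hbc u) H
  revert u v
  -- The pair is changed one index at a time and the two indices must stay distinct. If `k = q`, the
  -- second index is first moved to a third one, `m`.
  by_cases hkq : k = q
  · subst hkq
    obtain ⟨m, hmp, hmk⟩ := hι p k
    exact R hmk.symm hkl (L hmp.symm hmk.symm (R hpq hmp.symm hm))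
  · exact R hkq hkl (L hpq hkq hm)

/-- The lower-upper factorization of a 2 × 2 matrix with nonzero corner `1 + t b`. In the group it
requires multiplicativity of `h`, since the symbols are exactly the obstruction. -/
theorem rank_one {i j : ι} (hij : i ≠ j)
    (hm : ∀ u v : K, u ≠ 0 → v ≠ 0 → h e i j u * h e i j v = h e i j (u * v))
    (t b : K) (hv : 1 + t * b ≠ 0) :
    e i j t * e j i b =
      e j i (b / (1 + t * b)) * h e i j (1 + t * b) * e i j (t / (1 + t * b)) := by
  classical
  by_cases hb : b = 0
  · subst hb; simp [he.zero hij.symm, he.h_one hij]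
  set v := 1 + t * b with hvd
  have hji : ∀ {c : K}, c ≠ 0 → e j i c = e i j c⁻¹ * w e i j (-c⁻¹) * e i j c⁻¹ := by
    intro c hc
    simp [w, inv_neg, he.neg hij, mul_assoc]
  have hb' : b / v ≠ 0 := div_ne_zero hb hv
  -- Multiplicativity applied to `v` and `b⁻¹`: the factors `w e i j (-1)` cancel in `h (v / b) * (h
  -- b⁻¹)⁻¹`.
  have hww : h e i j v = w e i j (v / b) * w e i j (-b⁻¹) := by
    have := hm v b⁻¹ hv (inv_ne_zero hb)
    rw [← eq_mul_inv_iff_mul_eq] at this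
    rw [this, h, h, he.w_inv hij, he.w_inv hij]
    simp [mul_assoc, div_eq_mul_inv]
  have hs := he.h_semiconj hι hij hij hv (v⁻¹ * b⁻¹)
  rw [hji hb, hji hb', inv_div]
  have e1 : e i j (t / v) = e i j (-(v⁻¹ * b⁻¹)) * e i j b⁻¹ := by
    rw [← he.add hij]; congr 1; field_simp; rw [hvd]; ring
  have e2 : e i j (v / b) = e i j t * e i j b⁻¹ := by
    rw [← he.add hij]; congr 1; field_simp; rw [hvd]; ring
  have e3 : e i j (v/b) * h e i j v * e i j (-(v⁻¹ * b⁻¹)) = h e i j v := by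
    rw [he.neg hij, mul_inv_eq_iff_eq_mul, hs.eq]
    congr 2; simp [diagFun, hij.symm]; field_simp
  calc _ = e i j (v / b) * w e i j (-b⁻¹) * e i j b⁻¹ := by rw [e2]; simp only [mul_assoc]
    _ = e i j (v / b) * w e i j (-(v / b)) * (w e i j (v / b) * w e i j (-b⁻¹)) * e i j b⁻¹ := by
      rw [he.w_inv hij (v / b)]; simp only [mul_assoc, inv_mul_cancel_left]
    _ = _ := by rw [← hww, e1, ← e3]; rw [e3]; nth_rw 1 [← e3]; simp only [mul_assoc]

end IsSteinberg

end Steinberg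

/-! ### Column, row and Levi subgroups, and their matrix entries. -/

namespace Steinberg

open scoped commutatorElement

variable {ι K G : Type*} [Field K] [Group G]

/-- The subgroup generated by the elements `e_ij(t)` with `i ≠ j` and `P i j`. -/
def block (e : ι → ι → K → G) (P : ι → ι → Prop) : Subgroup G :=
  Subgroup.closure {x | ∃ i j t, i ≠ j ∧ P i j ∧ x = e i j t}

/-- The group of columns: generated by the `e_ik(t)` with `i ∈ A`. -/
def colGrp (e : ι → ι → K → G) (A : Finset ι) (k : ι) : Subgroup G :=
  block e fun i j => i ∈ A ∧ j = k

/-- The group of rows: generated by the `e_kj(t)` with `j ∈ A`. -/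
def rowGrp (e : ι → ι → K → G) (k : ι) (A : Finset ι) : Subgroup G :=
  block e fun i j => i = k ∧ j ∈ A

/-- The group generated by the `e_ij(t)` with `i, j ∈ S`. -/
def levi (e : ι → ι → K → G) (S : Finset ι) : Subgroup G :=
  block e fun i j => i ∈ S ∧ j ∈ S

/-- The group generated by the `e_ij(t)` with `i ∈ S ∪ {k}` and `j ∈ S`. -/
def parab (e : ι → ι → K → G) (k : ι) (S : Finset ι) : Subgroup G :=
  block e fun i j => (i = k ∨ i ∈ S) ∧ j ∈ S

/-- The big cell. -/
def cell (e : ι → ι → K → G) (k l : ι) (S : Finset ι) : Set G :=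
  {g | ∃ c ∈ colGrp e S k, ∃ u : K, u ≠ 0 ∧ ∃ q ∈ parab e k S, g = c * h e k l u * q}

omit [Field K] in
theorem mem_block {e : ι → ι → K → G} {P : ι → ι → Prop} {i j : ι} (hij : i ≠ j) (hP : P i j)
    (t : K) : e i j t ∈ block e P :=
  Subgroup.subset_closure ⟨i, j, t, hij, hP, rfl⟩

omit [Field K] in
theorem block_mono {e : ι → ι → K → G} {P P' : ι → ι → Prop} (H : ∀ i j, P i j → P' i j) :
    block e P ≤ block e P' := by
  refine Subgroup.closure_mono ?_
  rintro x ⟨i, j, t, hij, hP, rfl⟩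
  exact ⟨i, j, t, hij, H _ _ hP, rfl⟩

theorem rowGrp_eq (e : ι → ι → K → G) (k : ι) (A : Finset ι) :
    rowGrp e k A = colGrp (dual e) A k := by
  unfold rowGrp colGrp block
  congr 1
  ext x
  constructor
  · rintro ⟨i, j, t, hij, ⟨rfl, hj⟩, rfl⟩
    exact ⟨j, i, -t, hij.symm, ⟨hj, rfl⟩, by simp [dual]⟩
  · rintro ⟨i, j, t, hij, ⟨hj, rfl⟩, rfl⟩
    exact ⟨j, i, -t, hij.symm, ⟨rfl, hj⟩, by simp [dual]⟩

namespace IsSteinberg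

variable {e : ι → ι → K → G} (he : IsSteinberg e)
include he

/-- Normalization need only be tested on generators. The induction carries `x` and `x⁻¹` together,
because the step for inverses exchanges them. -/
theorem block_conj {P P' : ι → ι → Prop}
    (H : ∀ i j s k l t, i ≠ j → P i j → k ≠ l → P' k l →
      e i j s * e k l t * (e i j s)⁻¹ ∈ block e P') {x y : G} (hx : x ∈ block e P)
    (hy : y ∈ block e P') : x * y * x⁻¹ ∈ block e P' := by
  have gen : ∀ i j s, i ≠ j → P i j → ∀ y ∈ block e P',
      e i j s * y * (e i j s)⁻¹ ∈ block e P' := by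
    intro i j s hij hP y hy
    have : block e P' ≤ (block e P').comap (MulAut.conj (e i j s)).toMonoidHom := by
      refine (Subgroup.closure_le _).2 ?_
      rintro _ ⟨k, l, t, hkl, hP', rfl⟩
      exact H i j s k l t hij hP hkl hP'
    exact this hy
  have main : ∀ y ∈ block e P', x * y * x⁻¹ ∈ block e P' ∧ x⁻¹ * y * x ∈ block e P' := by
    refine Subgroup.closure_induction (p := fun x _ => ∀ y ∈ block e P',
      x * y * x⁻¹ ∈ block e P' ∧ x⁻¹ * y * x ∈ block e P') ?_ ?_ ?_ ?_ hx
    · rintro _ ⟨i, j, s, hij, hP, rfl⟩ y hy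
      refine ⟨gen i j s hij hP y hy, ?_⟩
      have := gen i j (-s) hij hP y hy
      rwa [he.neg hij, inv_inv] at this
    · intro y hy; simpa using hy
    · intro a b _ _ ha hb y hy
      constructor
      · have := (ha _ (hb y hy).1).1
        simpa [mul_assoc] using this
      · have := (hb _ (ha y hy).2).2
        simpa [mul_assoc] using this
    · intro a _ ha y hy
      simpa using (ha y hy).symm
  exact (main y hy).1

theorem levi_conj_col {S : Finset ι} {k : ι} (hk : k ∉ S) {x y : G} (hx : x ∈ levi e S)
    (hy : y ∈ colGrp e S k) : x * y * x⁻¹ ∈ colGrp e S k := by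
  refine he.block_conj ?_ hx hy
  rintro i j s a b t hij ⟨hi, hj⟩ hab ⟨ha, rfl⟩
  have hib : i ≠ b := fun h => hk (h ▸ hi)
  have hbj : b ≠ j := fun h => hk (h ▸ hj)
  by_cases hja : j = a
  · subst hja
    rw [he.mul_swap hij hab hib, mul_inv_cancel_right]
    exact mul_mem (mem_block hib ⟨hi, rfl⟩ _) (mem_block hab ⟨hj, rfl⟩ _)
  · rw [(he.comm hij hab hja hib s t).eq, mul_inv_cancel_right]
    exact mem_block hab ⟨ha, rfl⟩ _

omit he in
theorem levi_dual (S : Finset ι) : levi (Steinberg.dual e) S = levi e S := by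
  unfold levi block
  congr 1
  ext x
  constructor
  · rintro ⟨i, j, t, hij, ⟨hi, hj⟩, rfl⟩
    exact ⟨j, i, -t, hij.symm, ⟨hj, hi⟩, by simp [Steinberg.dual]⟩
  · rintro ⟨i, j, t, hij, ⟨hi, hj⟩, rfl⟩
    exact ⟨j, i, -t, hij.symm, ⟨hj, hi⟩, by simp [Steinberg.dual]⟩

theorem levi_conj_row {S : Finset ι} {k : ι} (hk : k ∉ S) {x y : G} (hx : x ∈ levi e S)
    (hy : y ∈ rowGrp e k S) : x * y * x⁻¹ ∈ rowGrp e k S := by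
  rw [rowGrp_eq] at hy ⊢
  rw [← levi_dual] at hx
  exact he.dual.levi_conj_col hk hx hy

omit [Field K] he in
theorem commute_block {P : ι → ι → Prop} {z : G} (H : ∀ i j t, i ≠ j → P i j → Commute z (e i j t))
    {x : G} (hx : x ∈ block e P) : Commute z x := by
  refine Subgroup.closure_induction (p := fun x _ => Commute z x) ?_ (Commute.one_right z)
    (fun a b _ _ ha hb => ha.mul_right hb) (fun a _ ha => ha.inv_right) hx
  rintro _ ⟨i, j, t, hij, hP, rfl⟩
  exact H i j t hij hP

theorem commute_col {A : Finset ι} {j k : ι} (hj : j ∉ A) (hk : k ∉ A) {x y : G}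
    (hx : x ∈ colGrp e A j) (hy : y ∈ colGrp e A k) : Commute x y := by
  refine commute_block (fun a b t hab ⟨ha, hb⟩ => ?_) hy
  refine (commute_block (fun a' b' t' hab' ⟨ha', hb'⟩ => ?_) hx).symm
  subst hb hb'
  exact he.comm hab hab' (fun h => hk (h ▸ ha')) (fun h => hj (h ▸ ha)) _ _

theorem commute_col_gen {A : Finset ι} {j k : ι} (hj : j ≠ k) (hk : k ∉ A) (t : K) {y : G}
    (hy : y ∈ colGrp e A k) : Commute (e j k t) y := by
  refine commute_block (fun a b s hab ⟨ha, hb⟩ => ?_) hy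
  subst hb
  exact he.comm hj hab (fun h => hk (h ▸ ha)) hj _ _

theorem col_decomp [DecidableEq ι] {A : Finset ι} {j k : ι} (hj : j ≠ k) (hk : k ∉ A) {x : G}
    (hx : x ∈ colGrp e (insert j A) k) : ∃ t, ∃ c ∈ colGrp e A k, x = c * e j k t := by
  refine Subgroup.closure_induction
    (p := fun x _ => ∃ t, ∃ c ∈ colGrp e A k, x = c * e j k t) ?_ ?_ ?_ ?_ hx
  · rintro _ ⟨i, _, t, hij, ⟨hi, rfl⟩, rfl⟩
    rcases Finset.mem_insert.1 hi with rfl | hi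
    · exact ⟨t, 1, one_mem _, by simp⟩
    · exact ⟨0, _, mem_block hij ⟨hi, rfl⟩ t, by simp [he.zero hj]⟩
  · exact ⟨0, 1, one_mem _, by simp [he.zero hj]⟩
  · rintro _ _ _ _ ⟨t, c, hc, rfl⟩ ⟨t', c', hc', rfl⟩
    refine ⟨t + t', c * c', mul_mem hc hc', ?_⟩
    have := (he.commute_col_gen hj hk t hc').eq
    rw [he.add hj, mul_assoc, ← mul_assoc _ c', this]
    simp only [mul_assoc]
  · rintro _ _ ⟨t, c, hc, rfl⟩
    refine ⟨-t, c⁻¹, inv_mem hc, ?_⟩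
    have := (he.commute_col_gen hj hk (-t) (inv_mem hc)).eq
    rw [← this, he.neg hj, mul_inv_rev]

/-- Moving `e k j t` past an element of column `k` costs only an error in column `j`. In
`gen_mul_cell` that error lies in the Levi subgroup, where it is harmless. -/
theorem gen_mul_col {A : Finset ι} {j k : ι} (hkj : k ≠ j) (hj : j ∉ A) (hk : k ∉ A) (t : K)
    {x : G} (hx : x ∈ colGrp e A k) :
    ∃ d ∈ colGrp e A j, e k j t * x = x * d * e k j t := by
  refine Subgroup.closure_induction
    (p := fun x _ => ∃ d ∈ colGrp e A j, e k j t * x = x * d * e k j t) ?_ ?_ ?_ ?_ hx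
  · rintro _ ⟨i, _, s, hij, ⟨hi, rfl⟩, rfl⟩
    have hij' : i ≠ j := fun h => hj (h ▸ hi)
    refine ⟨e i j (-(s * t)), mem_block hij' ⟨hi, rfl⟩ _, ?_⟩
    have h1 := he.mul_swap hij hkj hij' s t
    have h2 := (he.comm hij hij' hij.symm hij' s (-(s * t))).eq
    rw [h2, he.neg hij', mul_assoc, h1]
    simp only [mul_assoc, inv_mul_cancel_left]
  · exact ⟨1, one_mem _, by simp⟩
  · rintro a b _ hb ⟨d, hd, h1⟩ ⟨d', hd', h2⟩
    refine ⟨d * d', mul_mem hd hd', ?_⟩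
    have h3 := (he.commute_col hj hk hd hb).eq
    rw [← mul_assoc, h1, mul_assoc _ _ b, h2]
    simp only [mul_assoc]
    rw [← mul_assoc d b, h3]
    simp only [mul_assoc]
  · rintro a ha ⟨d, hd, h1⟩
    refine ⟨d⁻¹, inv_mem hd, ?_⟩
    have h3 := (he.commute_col hj hk (inv_mem hd) (inv_mem ha)).eq
    rw [← h3, mul_assoc, eq_inv_mul_iff_mul_eq, eq_inv_mul_iff_mul_eq, ← mul_assoc d,
      ← mul_assoc, ← mul_assoc, ← h1, mul_inv_cancel_right]

section torus

variable (hι : ∀ i j : ι, ∃ m, m ≠ i ∧ m ≠ j)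
include hι

theorem h_conj_block [DecidableEq ι] {P : ι → ι → Prop} {k l : ι} (hkl : k ≠ l) {u : K} (hu : u ≠ 0)
    {x : G} (hx : x ∈ block e P) :
    h e k l u * x * (h e k l u)⁻¹ ∈ block e P ∧ (h e k l u)⁻¹ * x * h e k l u ∈ block e P := by
  constructor
  · have : block e P ≤ (block e P).comap (MulAut.conj (h e k l u)).toMonoidHom := by
      refine (Subgroup.closure_le _).2 ?_
      rintro _ ⟨i, j, t, hij, hP, rfl⟩
      change h e k l u * e i j t * (h e k l u)⁻¹ ∈ block e P
      rw [(he.h_semiconj hι hkl hij hu t).eq, mul_inv_cancel_right]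
      exact mem_block hij hP _
    exact this hx
  · have : block e P ≤ (block e P).comap (MulAut.conj (h e k l u)⁻¹).toMonoidHom := by
      refine (Subgroup.closure_le _).2 ?_
      rintro _ ⟨i, j, t, hij, hP, rfl⟩
      change (h e k l u)⁻¹ * e i j t * (h e k l u)⁻¹⁻¹ ∈ block e P
      have hs := he.h_semiconj hι hkl hij hu
        ((diagFun k l u i)⁻¹ * (diagFun k l u j) * t)
      have e1 : diagFun k l u i * (diagFun k l u j)⁻¹ *
          ((diagFun k l u i)⁻¹ * (diagFun k l u j) * t) = t := by
        have a1 := diagFun_ne_zero k l hu i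
        have a2 := diagFun_ne_zero k l hu j
        field_simp
      rw [e1] at hs
      rw [inv_inv, mul_assoc, ← hs.eq, inv_mul_cancel_left]
      exact mem_block hij hP _
    have := this hx
    simpa using this

/-- The element `w e l j (-1)` lies in the Levi subgroup and conjugates `h e k l u` to `h e k j u`.
So the auxiliary index `l` in the big cell is immaterial modulo the Levi subgroup. -/
theorem h_change [DecidableEq ι] {S : Finset ι} {k l j : ι} (hk : k ∉ S) (hl : l ∈ S) (hj : j ∈ S)
    {u : K} (hu : u ≠ 0) : ∃ y ∈ levi e S, h e k j u = y * h e k l u := by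
  have hkl : k ≠ l := fun h => hk (h ▸ hl)
  have hkj : k ≠ j := fun h => hk (h ▸ hj)
  by_cases hlj : l = j
  · subst hlj; exact ⟨1, one_mem _, by simp⟩
  · have hm := (he.h_move_right hkl hlj hkj u).eq
    have hw : w e l j (-1) ∈ levi e S :=
      mul_mem (mul_mem (mem_block hlj ⟨hl, hj⟩ _) (mem_block (Ne.symm hlj) ⟨hj, hl⟩ _))
        (mem_block hlj ⟨hl, hj⟩ _)
    refine ⟨w e l j (-1) * (h e k l u * (w e l j (-1))⁻¹ * (h e k l u)⁻¹),
      mul_mem hw (he.h_conj_block hι hkl hu (inv_mem hw)).1, ?_⟩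
    simp only [mul_assoc, inv_mul_cancel, mul_one]
    rw [← mul_assoc, hm, mul_inv_cancel_right]

end torus

section matrix

variable [DecidableEq ι] [Fintype ι] {φ : G →* Matrix ι ι K}
  (hφ : ∀ i j t, i ≠ j → φ (e i j t) = Matrix.transvection i j t)
include hφ

omit he in
theorem entry_gen {i j : ι} (hij : i ≠ j) (t : K) (g : G) (a b : ι) :
    φ (e i j t * g) a b = φ g a b + if a = i then t * φ g j b else 0 := by
  rw [map_mul, hφ i j t hij]
  split_ifs with h
  · subst h; rw [Matrix.transvection_mul_apply_same]
  · rw [Matrix.transvection_mul_apply_of_ne _ _ _ _ h, add_zero]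

omit he in
theorem entry_gen_right {i j : ι} (hij : i ≠ j) (t : K) (g : G) (a b : ι) :
    φ (g * e i j t) a b = φ g a b + if b = j then t * φ g a i else 0 := by
  rw [map_mul, hφ i j t hij]
  split_ifs with h
  · subst h; rw [Matrix.mul_transvection_apply_same]
  · rw [Matrix.mul_transvection_apply_of_ne _ _ _ _ h, add_zero]

omit he in
theorem entry_w {i j : ι} (hij : i ≠ j) {u : K} (hu : u ≠ 0) (g : G) (a b : ι) :
    φ (w e i j u * g) a b =
      if a = i then u * φ g j b else if a = j then -u⁻¹ * φ g i b else φ g a b := by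
  simp only [w, mul_assoc]
  rw [entry_gen hφ hij, entry_gen hφ hij.symm, entry_gen hφ hij.symm, entry_gen hφ hij,
    entry_gen hφ hij, entry_gen hφ hij]
  by_cases hi : a = i
  · subst hi; simp [hij, hij.symm]; field_simp; ring
  · by_cases hj : a = j
    · subst hj; simp [hij.symm]; field_simp; ring
    · simp [hi, hj]

omit he in
theorem entry_h {i j : ι} (hij : i ≠ j) {u : K} (hu : u ≠ 0) (g : G) (a b : ι) :
    φ (h e i j u * g) a b = diagFun i j u a * φ g a b := by
  rw [h, mul_assoc, entry_w hφ hij hu, entry_w hφ hij (by simp), entry_w hφ hij (by simp),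
    entry_w hφ hij (by simp)]
  by_cases hi : a = i
  · subst hi; simp [hij.symm, diagFun, inv_neg]
  · by_cases hj : a = j
    · subst hj; simp [hij.symm, diagFun]
    · simp [hi, hj, diagFun]

omit he in
theorem row_trivial {P : ι → ι → Prop} {i : ι} (H : ∀ j, ¬ P i j) {x : G} (hx : x ∈ block e P)
    (g : G) (b : ι) : φ (x * g) i b = φ g i b := by
  refine Subgroup.closure_induction (p := fun x _ => ∀ g, φ (x * g) i b = φ g i b)
    ?_ (fun g => by rw [one_mul]) ?_ ?_ hx g
  · rintro _ ⟨k, l, t, hkl, hP, rfl⟩ g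
    rw [entry_gen hφ hkl, if_neg, add_zero]
    rintro rfl
    exact H l hP
  · intro a b _ _ ha hb g
    rw [mul_assoc, ha, hb]
  · intro a _ ha g
    rw [← ha, mul_inv_cancel_left]

omit he in
theorem col_trivial {P : ι → ι → Prop} {j : ι} (H : ∀ i, ¬ P i j) {x : G} (hx : x ∈ block e P)
    (g : G) (a : ι) : φ (g * x) a j = φ g a j := by
  refine Subgroup.closure_induction (p := fun x _ => ∀ g, φ (g * x) a j = φ g a j)
    ?_ (fun g => by rw [mul_one]) ?_ ?_ hx g
  · rintro _ ⟨k, l, t, hkl, hP, rfl⟩ g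
    rw [entry_gen_right hφ hkl, if_neg, add_zero]
    rintro rfl
    exact H k hP
  · intro a b _ _ ha hb g
    rw [← mul_assoc, hb, ha]
  · intro a _ ha g
    rw [← ha, inv_mul_cancel_right]

/-- Splitting off one index `j` of the column, its parameter is the entry `(j, k)` of the matrix,
because the remaining factors leave row `j` alone. -/
theorem col_faithful {A : Finset ι} {k : ι} (hk : k ∉ A) {c : G} (hc : c ∈ colGrp e A k)
    (H : ∀ i ∈ A, φ c i k = 0) : c = 1 := by
  induction A using Finset.induction_on generalizing c with
  | empty =>
    refine Subgroup.closure_induction (p := fun x _ => x = 1) ?_ rfl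
      (fun a b _ _ ha hb => by rw [ha, hb, one_mul]) (fun a _ ha => by rw [ha, inv_one]) hc
    rintro _ ⟨i, j, t, -, ⟨hi, -⟩, -⟩
    simp at hi
  | insert j A hj ih =>
    have hkA : k ∉ A := fun h => hk (Finset.mem_insert_of_mem h)
    have hjk : j ≠ k := fun h => hk (h ▸ Finset.mem_insert_self _ _)
    obtain ⟨t, c', hc', rfl⟩ := he.col_decomp hjk hkA hc
    have hk' : φ c' k k = 1 := by
      simpa using row_trivial hφ (i := k) (fun b hb => hkA hb.1) hc' 1 k
    have hj' : φ c' j k = 0 := by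
      simpa [hjk] using row_trivial hφ (i := j) (fun b hb => hj hb.1) hc' 1 k
    have h1 := H j (Finset.mem_insert_self _ _)
    rw [entry_gen_right hφ hjk, if_pos rfl, hj', zero_add] at h1
    have hjj : φ c' j j = 1 := by
      simpa using row_trivial hφ (i := j) (fun b hb => hj hb.1) hc' 1 j
    rw [hjj, mul_one] at h1
    subst h1
    rw [he.zero hjk, mul_one]
    rw [he.zero hjk, mul_one] at H
    exact ih hkA hc' fun i hi => H i (Finset.mem_insert_of_mem hi)

theorem row_faithful {A : Finset ι} {k : ι} (hk : k ∉ A) {r : G} (hr : r ∈ rowGrp e k A)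
    (H : ∀ i ∈ A, φ r k i = 0) : r = 1 := by
  -- The contragredient representation sends the dual family to transvections and turns rows into
  -- columns.
  let φ' : G →* Matrix ι ι K :=
    { toFun := fun g => (φ g⁻¹).transpose
      map_one' := by simp
      map_mul' := fun a b => by simp }
  have hφ' : ∀ i j t, i ≠ j → φ' (Steinberg.dual e i j t) = Matrix.transvection i j t := by
    intro i j t hij
    change (φ (e j i (-t))⁻¹).transpose = _
    rw [he.neg hij.symm, inv_inv, hφ _ _ _ hij.symm]
    simp [Matrix.transvection]
  rw [rowGrp_eq] at hr
  have := he.dual.col_faithful hφ' hk (inv_mem hr) (fun i hi => by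
    change (φ r⁻¹⁻¹).transpose i k = 0
    simpa using H i hi)
  simpa using this

end matrix

end IsSteinberg

end Steinberg

/-! ### The big cell and faithfulness by induction on the index set. -/

namespace Steinberg

open scoped commutatorElement

variable {ι K G : Type*} [Field K] [Group G]

namespace IsSteinberg

variable {e : ι → ι → K → G} (he : IsSteinberg e)
include he

variable [DecidableEq ι] [Fintype ι] (hι : ∀ i j : ι, ∃ m, m ≠ i ∧ m ≠ j)
  {φ : G →* Matrix ι ι K} (hφ : ∀ i j t, i ≠ j → φ (e i j t) = Matrix.transvection i j t)
  {S : Finset ι} {k l : ι} (hk : k ∉ S) (hl : l ∈ S)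

omit he [Fintype ι] [DecidableEq ι] in
theorem col_mul_cell {c g : G} (hc : c ∈ colGrp e S k) (hg : g ∈ cell e k l S) :
    c * g ∈ cell e k l S := by
  obtain ⟨c', hc', u, hu, q, hq, rfl⟩ := hg
  exact ⟨c * c', mul_mem hc hc', u, hu, q, hq, by simp only [mul_assoc]⟩

include hι hk hl

omit [Fintype ι] in
theorem levi_mul_cell {x g : G} (hx : x ∈ levi e S) (hg : g ∈ cell e k l S) :
    x * g ∈ cell e k l S := by
  have hkl : k ≠ l := fun h => hk (h ▸ hl)
  obtain ⟨c, hc, u, hu, q, hq, rfl⟩ := hg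
  have h1 := (he.h_conj_block hι hkl hu hx).2
  have h2 : (h e k l u)⁻¹ * x * h e k l u ∈ parab e k S :=
    block_mono (fun i j hij => ⟨Or.inr hij.1, hij.2⟩) h1
  refine ⟨x * c * x⁻¹, he.levi_conj_col hk hx hc, u, hu, _, mul_mem h2 hq, ?_⟩
  simp [mul_assoc]

include hφ

-- The factor `q` fixes the `k`-th basis vector, and `c` alters only the rows in `S`. Column `k`
-- therefore sees only `c` and the torus part, and the corner entry is `u`.
omit he hι in
theorem cell_entries {c q : G} {u : K} (hu : u ≠ 0) (hc : c ∈ colGrp e S k)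
    (hq : q ∈ parab e k S) :
    φ (c * h e k l u * q) k k = u ∧ ∀ j, φ (h e k l u * q) j k = if j = k then u else 0 := by
  have hkl : k ≠ l := fun h => hk (h ▸ hl)
  have hq' : ∀ a, φ q a k = (1 : Matrix ι ι K) a k := fun a => by
    simpa using col_trivial hφ (j := k) (fun i hi => hk hi.2) hq 1 a
  have h2 : ∀ j, φ (h e k l u * q) j k = if j = k then u else 0 := by
    intro j
    rw [entry_h hφ hkl hu, hq']
    split_ifs with h
    · subst h; simp [diagFun]
    · simp [h]
  refine ⟨?_, h2⟩
  rw [mul_assoc, row_trivial hφ (fun j hj => hk hj.1) hc, h2, if_pos rfl]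

/-- With `c = c' * e j k b`, the new corner entry is `(1 + t b) u`, so its being nonzero is the
condition for `rank_one` to refactor `e k j t * e j k b`. The errors that arise are Levi or row
elements and are absorbed on the left or in the parabolic factor; the two torus elements merge by
multiplicativity. -/
theorem gen_mul_cell
    (hm : ∀ i j, i ≠ j → ∀ u v : K, u ≠ 0 → v ≠ 0 → h e i j u * h e i j v = h e i j (u * v))
    {j : ι} (hj : j ∈ S) (t : K) {g : G}
    (hg : g ∈ cell e k l S) (hne : φ (e k j t * g) k k ≠ 0) : e k j t * g ∈ cell e k l S := by
  have hkl : k ≠ l := fun h => hk (h ▸ hl)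
  have hkj : k ≠ j := fun h => hk (h ▸ hj)
  obtain ⟨c, hc, u, hu, q, hq, rfl⟩ := hg
  have hkA : k ∉ S.erase j := fun h => hk (Finset.mem_of_mem_erase h)
  have hjA : j ∉ S.erase j := Finset.notMem_erase _ _
  obtain ⟨b, c', hc', rfl⟩ : ∃ t, ∃ c' ∈ colGrp e (S.erase j) k, c = c' * e j k t := by
    apply he.col_decomp hkj.symm hkA
    rwa [Finset.insert_erase hj]
  have hcS : c' ∈ colGrp e S k := block_mono (fun i j hij => ⟨Finset.mem_of_mem_erase hij.1, hij.2⟩) hc'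
  have hen := (cell_entries hφ hk hl hu hc hq)
  have h1 : φ (c' * e j k b * h e k l u * q) j k = b * u := by
    rw [mul_assoc, mul_assoc, row_trivial hφ (fun a ha => hjA ha.1) hc',
      entry_gen hφ hkj.symm, if_pos rfl, hen.2, hen.2, if_neg hkj.symm, if_pos rfl, zero_add]
  rw [entry_gen hφ hkj, if_pos rfl, hen.1, h1] at hne
  set v := 1 + t * b with hv
  have hv0 : v ≠ 0 := by
    intro h0
    apply hne
    rw [show u + t * (b * u) = v * u by rw [hv]; ring, h0, zero_mul]
  obtain ⟨d, hd, hcd⟩ := he.gen_mul_col hkj hjA hkA t hc'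
  have hr1 := he.rank_one hι hkj (hm k j hkj) t b hv0
  rw [← hv] at hr1
  obtain ⟨y, hy, hyh⟩ := he.h_change hι hk hl hj hv0
  have hdL : d ∈ levi e S := block_mono (fun i j' hij =>
    ⟨Finset.mem_of_mem_erase hij.1, hij.2 ▸ hj⟩) hd
  have hR : e k j (t / v) ∈ parab e k S := mem_block hkj ⟨Or.inl rfl, hj⟩ _
  have hq' := mul_mem (he.h_conj_block hι hkl hu hR).2 hq
  have hcell : h e k l (v * u) * ((h e k l u)⁻¹ * e k j (t / v) * h e k l u * q) ∈ cell e k l S :=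
    ⟨1, one_mem _, v * u, mul_ne_zero hv0 hu, _, hq', by rw [one_mul]⟩
  have h2 := he.levi_mul_cell hι hk hl hy hcell
  have h3 := col_mul_cell (mem_block hkj.symm ⟨hj, rfl⟩ (b / v)) h2
  have h4 := he.levi_mul_cell hι hk hl hdL h3
  have h5 := col_mul_cell hcS h4
  convert h5 using 1
  calc e k j t * (c' * e j k b * h e k l u * q)
      = (e k j t * c') * e j k b * h e k l u * q := by simp only [mul_assoc]
    _ = c' * d * (e k j t * e j k b) * h e k l u * q := by rw [hcd]; simp only [mul_assoc]
    _ = _ := by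
      rw [hr1, hyh, ← hm k l hkl v u hv0 hu]
      simp only [mul_assoc, mul_inv_cancel_left]

/-- The row is multiplied in one coordinate at a time by `gen_mul_cell`, which needs a nonzero
corner at every stage. A last coordinate `s` is therefore applied in two portions, `s'` before and
`s - s'` after the rest of the row. -/
theorem row_mul_cell
    (hm : ∀ i j, i ≠ j → ∀ u v : K, u ≠ 0 → v ≠ 0 → h e i j u * h e i j v = h e i j (u * v))
    (h2 : (2 : K) ≠ 0) {A : Finset ι} (hA : A ⊆ S) {r g : G} (hr : r ∈ rowGrp e k A)
    (hg : g ∈ cell e k l S) (hne : φ (r * g) k k ≠ 0) : r * g ∈ cell e k l S := by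
  induction A using Finset.induction_on generalizing r g with
  | empty =>
    have : r = 1 := he.row_faithful hφ (Finset.notMem_empty k) hr (by simp)
    subst this
    simpa using hg
  | insert j A hj ih =>
    have hjS : j ∈ S := hA (Finset.mem_insert_self _ _)
    have hAS : A ⊆ S := fun x hx => hA (Finset.mem_insert_of_mem hx)
    have hkA : k ∉ A := fun h => hk (hAS h)
    have hkj : k ≠ j := fun h => hk (h ▸ hjS)
    rw [rowGrp_eq] at hr
    obtain ⟨a, r, hr', rfl⟩ := he.dual.col_decomp hkj.symm hkA hr
    clear hr
    have hr : r ∈ rowGrp e k A := by rwa [rowGrp_eq]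
    change φ (r * e k j (-a) * g) k k ≠ 0 at hne
    change r * e k j (-a) * g ∈ _
    have hgk : ∀ x, x ∈ cell e k l S → φ x k k ≠ 0 := by
      rintro _ ⟨c, hc, u, hu, q, hq, rfl⟩
      rw [(cell_entries hφ hk hl hu hc hq).1]
      exact hu
    have hjr : ∀ x, φ (r * x) j k = φ x j k := fun x =>
      row_trivial hφ (fun b hb => hkj hb.1.symm) hr x k
    have hcomm : ∀ s, r * e k j s = e k j s * r := fun s => by
      have : Commute (e k j s) r := commute_block (fun x y z hxy hP => by
        obtain ⟨rfl, hy⟩ := hP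
        exact he.comm hkj hxy hkj.symm (fun h => hkA (h ▸ hy)) _ _) hr
      exact this.eq.symm
    obtain ⟨s, hs⟩ : ∃ s, s = -a := ⟨_, rfl⟩
    rw [← hs] at hne ⊢
    have step : ∀ s', φ (e k j s' * g) k k ≠ 0 → φ (r * (e k j s' * g)) k k ≠ 0 →
        r * e k j s * g ∈ cell e k l S := by
      intro s' h1 h1'
      have g1 := he.gen_mul_cell hι hφ hk hl hm hjS s' hg h1
      have g2 := ih hAS hr g1 h1'
      have e1 : r * e k j s * g = e k j (s - s') * (r * (e k j s' * g)) := by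
        rw [← mul_assoc r, hcomm s', mul_assoc _ r, ← mul_assoc, ← he.add hkj, sub_add_cancel, hcomm,
          mul_assoc]
      rw [e1] at hne ⊢
      exact he.gen_mul_cell hι hφ hk hl hm hjS _ g2 hne
    have hr1 : ∀ s', φ (r * (e k j s' * g)) k k = φ (r * g) k k + s' * φ g j k := by
      intro s'
      rw [← mul_assoc, hcomm, mul_assoc, entry_gen hφ hkj, if_pos rfl, hjr]
    have hr2 : ∀ s', φ (e k j s' * g) k k = φ g k k + s' * φ g j k := by
      intro s'
      rw [entry_gen hφ hkj, if_pos rfl]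
    have hg0 := hgk g hg
    -- Both intermediate corners are affine in `s'` with slope `φ g j k`, starting from `φ g k k`
    -- and `φ (r * g) k k`. The value `s' = 0` fails only if the second vanishes; then `s' = s`
    -- fails only if the first vanishes at `s`, and in that case `s / 2` halves nonzero numbers.
    by_cases h3 : φ (r * g) k k = 0
    · have hne' := hne
      rw [mul_assoc, hr1, h3, zero_add] at hne'
      by_cases h4 : φ g k k + s * φ g j k = 0
      · refine step (s / 2) ?_ ?_
        · rw [hr2]
          have : φ g k k + s / 2 * φ g j k = φ g k k / 2 := by
            field_simp
            linear_combination h4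
          rw [this]
          exact div_ne_zero hg0 h2
        · rw [hr1, h3, zero_add, div_mul_eq_mul_div]
          exact div_ne_zero hne' h2
      · refine step s ?_ ?_
        · rwa [hr2]
        · rwa [← mul_assoc]
    · refine step 0 ?_ ?_
      · rwa [hr2, zero_mul, add_zero]
      · rwa [hr1, zero_mul, add_zero]

/-- The translates of the big cell by the row group cover the group. -/
theorem exists_row_mul_mem_cell
    (hm : ∀ i j, i ≠ j → ∀ u v : K, u ≠ 0 → v ≠ 0 → h e i j u * h e i j v = h e i j (u * v))
    (h2 : (2 : K) ≠ 0) {g : G} (hg : g ∈ levi e (insert k S)) :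
    ∃ r ∈ rowGrp e k S, r * g ∈ cell e k l S := by
  have hkl : k ≠ l := fun h => hk (h ▸ hl)
  have key : ∀ y, y ∈ levi e (insert k S) → (∃ r ∈ rowGrp e k S, r * y ∈ cell e k l S) →
      ∀ i j t, i ≠ j → i ∈ insert k S → j ∈ insert k S →
      ∃ r ∈ rowGrp e k S, r * (e i j t * y) ∈ cell e k l S := by
    rintro g hgL ⟨r, hr, hrg⟩ i j t hij hi hj
    -- A row translate of the cell meets the set of nonzero corner only inside the cell itself.
    have hincl : ∀ {x}, φ x k k ≠ 0 → (∃ r ∈ rowGrp e k S, r * x ∈ cell e k l S) →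
        x ∈ cell e k l S := by
      rintro x hx ⟨r, hr, hrx⟩
      have := he.row_mul_cell hι hφ hk hl hm h2 (Finset.Subset.refl S) (inv_mem hr) hrx
        (by rwa [inv_mul_cancel_left])
      rwa [inv_mul_cancel_left] at this
    rcases Finset.mem_insert.1 hi with rfl | hiS
    · have hjS : j ∈ S := (Finset.mem_insert.1 hj).resolve_left hij.symm
      refine ⟨r * (e i j t)⁻¹, mul_mem hr (inv_mem (mem_block hij ⟨rfl, hjS⟩ t)), ?_⟩
      simpa [mul_assoc] using hrg
    rcases Finset.mem_insert.1 hj with rfl | hjS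
    swap
    · have hx : e i j t ∈ levi e S := mem_block hij ⟨hiS, hjS⟩ t
      refine ⟨_, he.levi_conj_row hk hx hr, ?_⟩
      have := he.levi_mul_cell hι hk hl hx hrg
      simpa [mul_assoc] using this
    -- The remaining generators are the column elements; here `j` has replaced the distinguished
    -- index `k`. If the corner of `g` is nonzero, `g` itself lies in the cell. Otherwise a row
    -- element must be found that restores a nonzero corner.
    by_cases hkk : φ g j j ≠ 0
    · exact ⟨1, one_mem _, by
        rw [one_mul]
        exact col_mul_cell (mem_block hij ⟨hiS, rfl⟩ t) (hincl hkk ⟨r, hr, hrg⟩)⟩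
    push Not at hkk
    have hrow : ∀ i ∈ S, ∀ a, φ (e j i a * g) j j ≠ 0 → e j i a * g ∈ cell e j l S := by
      intro i hi a hne
      have hji : j ≠ i := fun h => hk (h ▸ hi)
      refine hincl hne ⟨r * (e j i a)⁻¹, mul_mem hr (inv_mem (mem_block hji ⟨rfl, hi⟩ a)), ?_⟩
      simpa [mul_assoc] using hrg
    by_cases hik : φ g i j = 0
    -- An invertible matrix has no zero column, so a nonzero entry in this column occurs in some row
    -- `m ∈ S` other than `i`. Adding row `m` to row `j` brings `g` into the cell; the row element
    -- passes `e i j t` at the cost of a Levi element `e i m`.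
    · obtain ⟨m, hmS, hmi, hm0⟩ : ∃ m ∈ S, m ≠ i ∧ φ g m j ≠ 0 := by
        by_contra! hcon
        have hz : ∀ m, φ g m j = 0 := by
          intro m
          by_cases hmj : m = j
          · exact hmj ▸ hkk
          by_cases hmi : m = i
          · exact hmi ▸ hik
          by_cases hmS : m ∈ S
          · exact hcon m hmS hmi
          · have := row_trivial hφ (i := m)
              (fun b hb => (Finset.mem_insert.1 hb.1).elim hmj hmS) hgL 1 j
            simpa [hmj] using this
        have h1 : (φ g⁻¹ * φ g) j j = 1 := by rw [← map_mul]; simp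
        rw [Matrix.mul_apply] at h1
        simp [hz] at h1
      have hjm : j ≠ m := fun h => hk (h ▸ hmS)
      have hc := hrow m hmS 1 (by rw [entry_gen hφ hjm, if_pos rfl, hkk]; simpa using hm0)
      refine ⟨e j m 1, mem_block hjm ⟨rfl, hmS⟩ 1, ?_⟩
      have hs := he.mul_swap hij hjm hmi.symm t 1
      have hs' : e j m 1 * (e i j t * g) = e i m (-(t * 1)) * (e i j t * (e j m 1 * g)) := by
        rw [he.neg hmi.symm, eq_inv_mul_iff_mul_eq]
        simp only [← mul_assoc]
        rw [hs]
      rw [hs']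
      exact he.levi_mul_cell hι hk hl (mem_block hmi.symm ⟨hiS, hmS⟩ _)
        (col_mul_cell (mem_block hij ⟨hiS, rfl⟩ _) hc)
    · by_cases ht : t = 0
      · subst ht; exact ⟨r, hr, by rwa [he.zero hij, one_mul]⟩
      -- With `a = -t⁻¹`, the two expressions for the Weyl element give the braid identity `e j i a
      -- * e i j t * e j i a = e i j t * e j i a * e i j t`. It rewrites the product so that the
      -- cell is reached through nonzero corners.
      have hw := he.w_swap hι hij ht
      obtain ⟨a, ha⟩ : ∃ a, a = -t⁻¹ := ⟨_, rfl⟩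
      have ha0 : a ≠ 0 := by simp [ha, ht]
      have hta : t * a = -1 := by rw [ha]; field_simp
      have hainv : -a⁻¹ = t := by rw [ha, inv_neg, inv_inv, neg_neg]
      simp only [w] at hw
      rw [← ha, hainv] at hw
      have e1 : e j i a * (e i j t * g) = e i j t * (e j i a * (e i j t * (e j i (-a) * g))) := by
        calc e j i a * (e i j t * g) = e j i a * e i j t * e j i a * (e j i (-a) * g) := by
              rw [he.neg hij.symm a]; simp only [mul_assoc, mul_inv_cancel_left]
          _ = _ := by rw [hw]; simp only [mul_assoc]
      refine ⟨e j i a, mem_block hij.symm ⟨rfl, hiS⟩ _, ?_⟩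
      rw [e1]
      have c1 := hrow i hiS (-a) (by
        rw [entry_gen hφ hij.symm, if_pos rfl, hkk, zero_add]
        exact mul_ne_zero (neg_ne_zero.2 ha0) hik)
      have hC := mem_block (e := e) (P := fun a b => a ∈ S ∧ b = j) hij ⟨hiS, rfl⟩ t
      refine col_mul_cell hC (he.gen_mul_cell hι hφ hk hl hm hiS a (col_mul_cell hC c1) ?_)
      rw [entry_gen hφ hij.symm, entry_gen hφ hij, entry_gen hφ hij, entry_gen hφ hij.symm,
        entry_gen hφ hij.symm, hkk]
      simp only [if_true, hij, hij.symm, if_false, zero_add, add_zero]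
      have : -a * φ g i j + a * (φ g i j + t * (-a * φ g i j)) = a * φ g i j := by
        linear_combination (-a * φ g i j) * hta
      rw [this]
      exact mul_ne_zero ha0 hik
  refine Subgroup.closure_induction_left
    (p := fun x _ => ∃ r ∈ rowGrp e k S, r * x ∈ cell e k l S) ?_ ?_ ?_ hg
  · exact ⟨1, one_mem _, 1, one_mem _, 1, one_ne_zero, 1, one_mem _, by simp [he.h_one hkl]⟩
  · rintro _ ⟨i, j, t, hij, ⟨hi, hj⟩, rfl⟩ y hy hr
    exact key y hy hr i j t hij hi hj
  · rintro _ ⟨i, j, t, hij, ⟨hi, hj⟩, rfl⟩ y hy hr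
    rw [← he.neg hij]
    exact key y hy hr i j _ hij hi hj

omit [Fintype ι] [DecidableEq ι] hι hφ hl in
theorem parab_decomp {q : G} (hq : q ∈ parab e k S) :
    ∃ r ∈ rowGrp e k S, ∃ x ∈ levi e S, q = r * x := by
  refine Subgroup.closure_induction
    (p := fun q _ => ∃ r ∈ rowGrp e k S, ∃ x ∈ levi e S, q = r * x) ?_ ?_ ?_ ?_ hq
  · rintro _ ⟨i, j, t, hij, ⟨hi, hj⟩, rfl⟩
    rcases hi with rfl | hi
    · exact ⟨_, mem_block hij ⟨rfl, hj⟩ t, 1, one_mem _, by simp⟩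
    · exact ⟨1, one_mem _, _, mem_block hij ⟨hi, hj⟩ t, by simp⟩
  · exact ⟨1, one_mem _, 1, one_mem _, by simp⟩
  · rintro _ _ _ _ ⟨r, hr, x, hx, rfl⟩ ⟨r', hr', x', hx', rfl⟩
    exact ⟨_, mul_mem hr (he.levi_conj_row hk hx hr'), _, mul_mem hx hx', by simp [mul_assoc]⟩
  · rintro _ _ ⟨r, hr, x, hx, rfl⟩
    refine ⟨_, he.levi_conj_row hk (inv_mem hx) (inv_mem hr), _, inv_mem hx, by simp⟩

-- An element of the kernel has corner 1, hence lies in the cell with `u = 1`. Its column part, then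
-- the row part of its parabolic factor, are detected by matrix entries and so are trivial; the rest
-- lies in the Levi subgroup on `S`.
omit hk hl in
theorem levi_faithful
    (hm : ∀ i j, i ≠ j → ∀ u v : K, u ≠ 0 → v ≠ 0 → h e i j u * h e i j v = h e i j (u * v))
    (h2 : (2 : K) ≠ 0) (S : Finset ι) {g : G} (hg : g ∈ levi e S) (h1 : φ g = 1) : g = 1 := by
  induction S using Finset.induction_on generalizing g with
  | empty =>
    refine Subgroup.closure_induction (p := fun x _ => x = 1) ?_ rfl
      (fun a b _ _ ha hb => by rw [ha, hb, one_mul]) (fun a _ ha => by rw [ha, inv_one]) hg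
    rintro _ ⟨i, j, t, -, ⟨hi, -⟩, -⟩
    simp at hi
  | insert k S hk ih =>
    rcases S.eq_empty_or_nonempty with rfl | ⟨l, hl⟩
    · refine Subgroup.closure_induction (p := fun x _ => x = 1) ?_ rfl
        (fun a b _ _ ha hb => by rw [ha, hb, one_mul]) (fun a _ ha => by rw [ha, inv_one]) hg
      rintro _ ⟨i, j, t, hij, ⟨hi, hj⟩, -⟩
      simp at hi hj
      exact absurd (hi.trans hj.symm) hij
    have hkl : k ≠ l := fun h => hk (h ▸ hl)
    obtain ⟨r, hr, hrg⟩ := he.exists_row_mul_mem_cell hι hφ hk hl hm h2 hg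
    have hgc : g ∈ cell e k l S := by
      have := he.row_mul_cell hι hφ hk hl hm h2 (Finset.Subset.refl S) (inv_mem hr) hrg
        (by rw [inv_mul_cancel_left, h1]; simp)
      rwa [inv_mul_cancel_left] at this
    obtain ⟨c, hc, u, hu, q, hq, rfl⟩ := hgc
    have hen := cell_entries hφ hk hl hu hc hq
    have hu1 : u = 1 := by rw [← hen.1, h1]; simp
    subst hu1
    rw [he.h_one hkl, mul_one] at h1
    have hcinv : ∀ i ∈ S, φ c i k = 0 := by
      intro i hi
      have hik : i ≠ k := fun h => hk (h ▸ hi)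
      rw [← col_trivial hφ (fun i hi => hk hi.2) hq, h1]
      simp [hik]
    have hc1 := he.col_faithful hφ hk hc hcinv
    subst hc1
    rw [one_mul] at h1
    rw [one_mul, he.h_one hkl, one_mul]
    obtain ⟨r, hr, x, hx, rfl⟩ := he.parab_decomp hk hq
    have hr1 : r = 1 := by
      refine he.row_faithful hφ hk hr fun i hi => ?_
      have hki : k ≠ i := fun h => hk (h ▸ hi)
      have hrx : φ r = φ x⁻¹ := by
        rw [← mul_one (φ x⁻¹), ← h1]
        have : r = r * x * x⁻¹ := by simp
        rw [this, map_mul, h1]; simp [h1]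
      rw [hrx]
      have := row_trivial hφ (fun b hb => hk hb.1) (inv_mem hx) 1 i
      simpa [hki] using this
    subst hr1
    rw [one_mul] at h1 ⊢
    exact ih hx h1

end IsSteinberg

end Steinberg

/-! ### The kernel is generated by symbols; surjectivity onto determinant 1. -/

namespace Steinberg

open scoped commutatorElement

variable {ι K G : Type*} [Field K] [Group G]

theorem map_w {G' : Type*} [Group G'] (f : G →* G') (e : ι → ι → K → G) (i j : ι) (u : K) :
    f (w e i j u) = w (fun a b t => f (e a b t)) i j u := by
  simp [w]

theorem map_h {G' : Type*} [Group G'] (f : G →* G') (e : ι → ι → K → G) (i j : ι) (u : K) :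
    f (h e i j u) = h (fun a b t => f (e a b t)) i j u := by
  simp [h, map_w]

namespace IsSteinberg

variable {e : ι → ι → K → G} (he : IsSteinberg e)
include he

theorem map {G' : Type*} [Group G'] (f : G →* G') : IsSteinberg fun a b t => f (e a b t) where
  add hij s t := by rw [he.add hij, map_mul]
  comm hij hkl hjk hil s t := (he.comm hij hkl hjk hil s t).map f
  mul hij hjk hik s t := by rw [← map_commutatorElement, he.mul hij hjk hik]

variable [DecidableEq ι] [Fintype ι] (hι : ∀ i j : ι, ∃ m, m ≠ i ∧ m ≠ j)
  {φ : G →* Matrix ι ι K} (hφ : ∀ i j t, i ≠ j → φ (e i j t) = Matrix.transvection i j t)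
  (hgen : block e (fun _ _ => True) = ⊤) (h2 : (2 : K) ≠ 0)

include hι hφ hgen h2 in
theorem eq_one_of_map_eq_one {p q : ι} (hpq : p ≠ q)
    (hm : ∀ u v : K, u ≠ 0 → v ≠ 0 → h e p q u * h e p q v = h e p q (u * v))
    {g : G} (hg : φ g = 1) : g = 1 := by
  refine he.levi_faithful hι hφ (fun i j hij u v hu hv => he.h_mult hι hpq hm hij u v hu hv) h2
    Finset.univ ?_ hg
  have : (⊤ : Subgroup G) ≤ levi e Finset.univ := by
    rw [← hgen]
    exact block_mono fun i j _ => ⟨Finset.mem_univ _, Finset.mem_univ _⟩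
  exact this (Subgroup.mem_top g)

omit he in
include hφ in
theorem map_symbol {p q : ι} (hpq : p ≠ q) {u v : K} (hu : u ≠ 0) (hv : v ≠ 0) :
    φ (h e p q u * h e p q v * (h e p q (u * v))⁻¹) = 1 := by
  have : φ (h e p q u * h e p q v) = φ (h e p q (u * v)) := by
    ext a b
    have h1 := entry_h hφ hpq hv 1 a b
    have h2 := entry_h hφ hpq (mul_ne_zero hu hv) 1 a b
    rw [mul_one] at h1 h2
    rw [entry_h hφ hpq hu, h1, h2, diagFun_mul, mul_assoc]
  rw [map_mul, this, ← map_mul, mul_inv_cancel, map_one]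

include hι hφ hgen h2 in
/-- The kernel of the map to matrices is generated by the symbols of any one pair of indices. -/
theorem map_eq_one_iff {p q : ι} (hpq : p ≠ q) (g : G) :
    φ g = 1 ↔ g ∈ Subgroup.closure {x | ∃ u v : K, u ≠ 0 ∧ v ≠ 0 ∧
      x = h e p q u * h e p q v * (h e p q (u * v))⁻¹} := by
  set Z := Subgroup.closure {x | ∃ u v : K, u ≠ 0 ∧ v ≠ 0 ∧
      x = h e p q u * h e p q v * (h e p q (u * v))⁻¹} with hZ
  have hker : ∀ z ∈ Z, φ z = 1 := by
    intro z hz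
    refine Subgroup.closure_induction (p := fun z _ => φ z = 1) ?_ (map_one φ)
      (fun a b _ _ ha hb => by rw [map_mul, ha, hb, one_mul]) (fun a _ ha => ?_) hz
    · rintro _ ⟨u, v, hu, hv, rfl⟩
      exact map_symbol hφ hpq hu hv
    · calc φ a⁻¹ = φ a * φ a⁻¹ := by rw [ha, one_mul]
        _ = 1 := by rw [← map_mul, mul_inv_cancel, map_one]
  refine ⟨fun hg => ?_, hker g⟩
  -- Centrality makes `Z` normal, so that the quotient is again generated by a Steinberg family, now
  -- with multiplicative `h`, and faithfulness applies there.
  have hcen : Z ≤ Subgroup.center G := by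
    refine (Subgroup.closure_le _).2 ?_
    rintro _ ⟨u, v, hu, hv, rfl⟩
    refine Subgroup.mem_center_iff.2 fun x => ?_
    have hx : x ∈ block e (fun _ _ => True) := hgen ▸ Subgroup.mem_top x
    exact (commute_block (fun i j t hij _ => he.symbol_commute hι hpq hij hu hv t) hx).eq.symm
  have hnorm : Z.Normal := ⟨fun z hz x => by
    rw [Subgroup.mem_center_iff.1 (hcen hz) x, mul_inv_cancel_right]; exact hz⟩
  have heq : ∀ a b : G, QuotientGroup.con Z a b → φ a = φ b := by
    intro a b hab
    have h1 : φ (a⁻¹ * b) = 1 := hker _ (QuotientGroup.leftRel_apply.1 hab)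
    rw [← mul_one (φ a), ← h1, ← map_mul, mul_inv_cancel_left]
  let φ' : G ⧸ Z →* Matrix ι ι K := Con.lift (QuotientGroup.con Z) φ heq
  have hφ' : ∀ x : G, φ' (QuotientGroup.mk' Z x) = φ x := fun x => rfl
  have hgen' : block (fun a b t => QuotientGroup.mk' Z (e a b t)) (fun _ _ => True) = ⊤ := by
    rw [eq_top_iff, ← Subgroup.map_top_of_surjective _ (QuotientGroup.mk'_surjective Z), ← hgen,
      block, MonoidHom.map_closure, Subgroup.closure_le]
    rintro _ ⟨_, ⟨i, j, t, hij, -, rfl⟩, rfl⟩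
    exact Subgroup.subset_closure ⟨i, j, t, hij, trivial, rfl⟩
  have := (he.map (QuotientGroup.mk' Z)).eq_one_of_map_eq_one hι (φ := φ')
    (fun i j t hij => (hφ' _).trans (hφ i j t hij)) hgen' h2 hpq (fun u v hu hv => by
      simp only [← map_h]
      rw [← map_mul, ← mul_inv_eq_one, ← map_inv, ← map_mul, QuotientGroup.mk'_apply,
        QuotientGroup.eq_one_iff]
      exact Subgroup.subset_closure ⟨u, v, hu, hv, rfl⟩) (g := QuotientGroup.mk' Z g)
    ((hφ' g).trans hg)
  exact (QuotientGroup.eq_one_iff g).1 this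

end IsSteinberg

/-- Gaussian elimination leaves a diagonal matrix of determinant 1. It is a product of diagonal
matrices with entries `u`, `u⁻¹` at two places, each the image of some `h e i l u`. -/
theorem exists_map_eq [DecidableEq ι] [Fintype ι] {e : ι → ι → K → G} {φ : G →* Matrix ι ι K}
    (hφ : ∀ i j t, i ≠ j → φ (e i j t) = Matrix.transvection i j t)
    {M : Matrix ι ι K} (hM : M.det = 1) : ∃ g, φ g = M := by
  obtain ⟨L, L', D, hD⟩ := Matrix.Pivot.exists_list_transvec_mul_diagonal_mul_list_transvec M
  have hL : ∀ L : List (Matrix.TransvectionStruct ι K), ∃ g, φ g = (L.map Matrix.TransvectionStruct.toMatrix).prod := by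
    intro L
    induction L with
    | nil => exact ⟨1, by simp⟩
    | cons x L ih =>
      obtain ⟨g, hg⟩ := ih
      exact ⟨e x.i x.j x.c * g, by simp [hg, hφ _ _ _ x.hij, Matrix.TransvectionStruct.toMatrix]⟩
  have hdet : ∏ i, D i = 1 := by
    have := congrArg Matrix.det hD
    simpa [hM, Matrix.det_mul] using this.symm
  have hD0 : ∀ i, D i ≠ 0 := by
    intro i hi
    rw [Finset.prod_eq_zero (Finset.mem_univ i) hi] at hdet
    exact zero_ne_one hdet
  let T : Subgroup (ι → Kˣ) :=
    { carrier := {d | ∃ g, φ g = Matrix.diagonal fun i => (d i : K)}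
      one_mem' := ⟨1, by simp⟩
      mul_mem' := by
        rintro a b ⟨g, hg⟩ ⟨g', hg'⟩
        exact ⟨g * g', by rw [map_mul, hg, hg', Matrix.diagonal_mul_diagonal]; rfl⟩
      inv_mem' := by
        rintro a ⟨g, hg⟩
        refine ⟨g⁻¹, ?_⟩
        have h1 : φ g⁻¹ * φ g = 1 := by rw [← map_mul, inv_mul_cancel, map_one]
        have h2 : φ g * Matrix.diagonal (fun i => ((a⁻¹ i : Kˣ) : K)) = 1 := by
          rw [hg, Matrix.diagonal_mul_diagonal]; simp
        exact left_inv_eq_right_inv h1 h2 }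
  have hpair : ∀ i l : ι, ∀ u : Kˣ, Pi.mulSingle i u * (Pi.mulSingle l u)⁻¹ ∈ T := by
    intro i l u
    by_cases hil : i = l
    · subst hil; simp [one_mem]
    · refine ⟨h e i l u, ?_⟩
      ext a b
      have h1 := IsSteinberg.entry_h hφ hil u.ne_zero 1 a b
      rw [mul_one] at h1
      rw [h1, map_one]
      by_cases hab : a = b
      · subst hab
        by_cases hai : a = i
        · subst hai; simp [diagFun, hil]
        · by_cases hal : a = l
          · subst hal; simp [diagFun, hai]
          · simp [diagFun, hai, hal]
      · simp [hab]
  let d : ι → Kˣ := fun i => Units.mk0 (D i) (hD0 i)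
  have hdT : d ∈ T := by
    rcases isEmpty_or_nonempty ι with hemp | ⟨⟨l⟩⟩
    · rw [Subsingleton.elim d 1]; exact one_mem _
    have hprod : ∏ i, (Pi.mulSingle i (d i) * (Pi.mulSingle l (d i))⁻¹ : ι → Kˣ) = d := by
      rw [Finset.prod_mul_distrib, Finset.univ_prod_mulSingle, Finset.prod_inv_distrib]
      have : ∏ i, (Pi.mulSingle l (d i) : ι → Kˣ) = Pi.mulSingle l (∏ i, d i) :=
        (map_prod (MonoidHom.mulSingle (fun _ : ι => Kˣ) l) d Finset.univ).symm
      rw [this]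
      have h1 : ∏ i, d i = 1 := by
        ext; simpa [d] using hdet
      rw [h1]; simp
    rw [← hprod]
    exact prod_mem fun i _ => hpair i l (d i)
  obtain ⟨g, hg⟩ := hdT
  obtain ⟨g1, hg1⟩ := hL L
  obtain ⟨g2, hg2⟩ := hL L'
  exact ⟨g1 * g * g2, by rw [map_mul, map_mul, hg1, hg2, hg, hD]; rfl⟩

end Steinberg

/-! ### Weights, roots and their norms. -/

namespace SLRel

open scoped commutatorElement

variable {n : ℕ}

/-- The weight of a coordinate vector of `K^{2n}` with respect to `D₊`. -/
def idxWt : Fin n ⊕ Fin n → (Fin n → ℤ) := Sum.elim L fun i => -L i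

theorem idxWt_swap (a : Fin n ⊕ Fin n) : idxWt a.swap = -idxWt a := by
  cases a <;> simp [idxWt]

theorem idxWt_dotProduct (a b : Fin n ⊕ Fin n) :
    idxWt a ⬝ᵥ idxWt b = (if a = b then 1 else 0) - if a = b.swap then 1 else 0 := by
  rcases a with i | i <;> rcases b with j | j <;>
    simp [idxWt, L, Pi.single_apply, eq_comm]

theorem swap_ne (a : Fin n ⊕ Fin n) : a.swap ≠ a := by cases a <;> simp

theorem idxWt_injective : Function.Injective (idxWt (n := n)) := by
  intro a b hab
  have h1 := idxWt_dotProduct a b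
  rw [← hab, idxWt_dotProduct, if_pos rfl, if_neg (swap_ne a).symm] at h1
  by_contra hne
  rw [if_neg hne] at h1
  split_ifs at h1 <;> simp at h1

/-- The weights of the coordinate vectors are `± L_i`, orthonormal up to sign. Pairing both sides
with `idxWt a` forces `a = c` or `a = d.swap`, so a root space occupies at most two positions. -/
theorem idxWt_sub_eq {a b c d : Fin n ⊕ Fin n} (hab : a ≠ b)
    (h : idxWt a - idxWt b = idxWt c - idxWt d) :
    (a = c ∧ b = d) ∨ (a = d.swap ∧ b = c.swap) := by
  have h1 : idxWt a ⬝ᵥ (idxWt a - idxWt b) = idxWt a ⬝ᵥ (idxWt c - idxWt d) := by rw [h]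
  simp only [dotProduct_sub, idxWt_dotProduct, if_neg hab, if_true, if_neg (swap_ne a).symm] at h1
  by_cases hac : a = c
  · subst hac
    exact Or.inl ⟨rfl, idxWt_injective (sub_right_injective h)⟩
  by_cases had : a = d.swap
  · refine Or.inr ⟨had, idxWt_injective ?_⟩
    have h2 : idxWt a = - idxWt d := by rw [had, idxWt_swap]
    rw [idxWt_swap]
    rw [h2] at h
    have h3 : idxWt b = -idxWt c := by
      have : -idxWt d - idxWt b = idxWt c - idxWt d := h
      linear_combination -this
    exact h3
  · rw [if_neg hac, if_neg had] at h1
    split_ifs at h1 <;> simp at h1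

theorem idxWt_sub_norm_le (a b : Fin n ⊕ Fin n) :
    (idxWt a - idxWt b) ⬝ᵥ (idxWt a - idxWt b) ≤ 4 := by
  simp only [dotProduct_sub, sub_dotProduct, idxWt_dotProduct, if_true, if_neg (swap_ne _).symm]
  split_ifs <;> simp

/-- The position of the first coordinate of the root vectors of a root. -/
def Root.pos : Root n → (Fin n ⊕ Fin n) × (Fin n ⊕ Fin n)
  | .sub i j _ => (.inl i, .inl j)
  | .add i j _ => (.inl i, .inr j)
  | .negAdd i j _ => (.inr j, .inl i)
  | .long i => (.inl i, .inr i)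
  | .negLong i => (.inr i, .inl i)

theorem Root.pos_ne (r : Root n) : r.pos.1 ≠ r.pos.2 := by
  cases r <;> simp_all [Root.pos]

theorem Root.wt_eq (r : Root n) : r.wt = idxWt r.pos.1 - idxWt r.pos.2 := by
  cases r <;> simp [Root.pos, Root.wt, idxWt, two_mul, sub_eq_add_neg, add_comm]

theorem Root.wt_injective : Function.Injective (Root.wt (n := n)) := by
  intro r p h
  rw [Root.wt_eq, Root.wt_eq] at h
  have := idxWt_sub_eq r.pos_ne h
  cases r <;> cases p <;> simp_all [Root.pos] <;> omega

theorem exists_root {a b : Fin n ⊕ Fin n} (hab : a ≠ b) :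
    ∃ r : Root n, r.wt = idxWt a - idxWt b := by
  rcases a with i | i <;> rcases b with j | j
  · exact ⟨.sub i j (by simpa using hab), by simp [Root.wt, idxWt]⟩
  · rcases lt_trichotomy i j with h | rfl | h
    · exact ⟨.add i j h, by simp [Root.wt, idxWt]⟩
    · exact ⟨.long i, by simp [Root.wt, idxWt, two_mul]⟩
    · exact ⟨.add j i h, by simp [Root.wt, idxWt, add_comm]⟩
  · rcases lt_trichotomy i j with h | rfl | h
    · exact ⟨.negAdd i j h, by simp [Root.wt, idxWt]⟩
    · exact ⟨.negLong i, by simp [Root.wt, idxWt, two_mul, sub_eq_add_neg]⟩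
    · exact ⟨.negAdd j i h, by simp [Root.wt, idxWt, sub_eq_add_neg, add_comm]⟩
  · exact ⟨.sub j i (by simpa using hab.symm), by simp [Root.wt, idxWt, sub_eq_add_neg, add_comm]⟩

theorem Root.wt_ne_zero (r : Root n) : r.wt ≠ 0 := by
  rw [Root.wt_eq, sub_ne_zero]
  exact fun h => r.pos_ne (idxWt_injective h)

theorem Root.norm_wt (r : Root n) :
    (r.wt ⬝ᵥ r.wt = 2) ∨ (r.wt ⬝ᵥ r.wt = 4 ∧ r.wt = 2 • idxWt r.pos.1) := by
  by_cases h : r.pos.1 = r.pos.2.swap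
  · right
    have h2 : r.wt = 2 • idxWt r.pos.1 := by
      rw [Root.wt_eq, two_nsmul, sub_eq_add_neg, ← idxWt_swap, ← h]
    refine ⟨?_, h2⟩
    rw [h2]
    simp only [smul_dotProduct, dotProduct_smul, idxWt_dotProduct, if_true,
      if_neg (swap_ne _).symm]
    norm_num
  · left
    have h' : r.pos.2 ≠ r.pos.1.swap := fun h' => h (by rw [h', Sum.swap_swap])
    rw [Root.wt_eq]
    simp [dotProduct_sub, sub_dotProduct, idxWt_dotProduct, (swap_ne _).symm, h, h', r.pos_ne,
      r.pos_ne.symm]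

theorem Root.norm_add_pos {r p : Root n} (h : r.wt + p.wt ≠ 0) :
    0 < r.wt ⬝ᵥ r.wt + p.wt ⬝ᵥ p.wt + 2 * (r.wt ⬝ᵥ p.wt) := by
  have h0 : 0 < (r.wt + p.wt) ⬝ᵥ (r.wt + p.wt) := by
    refine lt_of_le_of_ne (Finset.sum_nonneg fun i _ => mul_self_nonneg _) fun h0 => h ?_
    exact dotProduct_self_eq_zero.1 h0.symm
  simp only [add_dotProduct, dotProduct_add, dotProduct_comm p.wt r.wt] at h0
  linarith

theorem eq_one_of_le_two {i j : ℤ} (hi : 1 ≤ i) (hj : 1 ≤ j) (h1 : i * j ≤ 2)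
    (h2 : (i - j) ^ 2 + i * j ≤ 2) : i = 1 ∧ j = 1 := by
  have hi2 : i ≤ 2 := by nlinarith
  have hj2 : j ≤ 2 := by nlinarith
  interval_cases i <;> interval_cases j <;> first | exact ⟨rfl, rfl⟩ | (exfalso; revert h1 h2; norm_num)

theorem eq_one_or_two_of_le_two {i j : ℤ} (hi : 1 ≤ i) (hj : 1 ≤ j)
    (h : (i - j) ^ 2 + j ^ 2 ≤ 2) : (i = 1 ∨ i = 2) ∧ j = 1 := by
  have hj2 : j ≤ 1 := by nlinarith [sq_nonneg (i - j)]
  obtain rfl : j = 1 := le_antisymm hj2 hj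
  have hi2 : i ≤ 2 := by nlinarith
  refine ⟨?_, rfl⟩
  omega

/-- `A`, `B`, `C` stand for the inner products of two roots. Divisibility of `C` and positivity of
`A + B + 2 C` bound the form below, so only a few coefficient pairs have norm at most 4; sums of two
such pairs are checked by cases. -/
theorem quadForm_sum_gt {A B C i j i' j' : ℤ} (hA : A = 2 ∨ A = 4) (hB : B = 2 ∨ B = 4)
    (hAC : A = 4 → 2 ∣ C) (hBC : B = 4 → 2 ∣ C) (hABC : A = 4 → B = 4 → 4 ∣ C)
    (hpos : 0 < A + B + 2 * C) (hi : 1 ≤ i) (hj : 1 ≤ j) (hi' : 1 ≤ i') (hj' : 1 ≤ j')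
    (h : A * i ^ 2 + 2 * C * (i * j) + B * j ^ 2 ≤ 4)
    (h' : A * i' ^ 2 + 2 * C * (i' * j') + B * j' ^ 2 ≤ 4) :
    4 < A * (i + i') ^ 2 + 2 * C * ((i + i') * (j + j')) + B * (j + j') ^ 2 := by
  have hij : 1 ≤ i * j := by nlinarith
  have hij' : 1 ≤ i' * j' := by nlinarith
  rcases hA with rfl | rfl <;> rcases hB with rfl | rfl
  · have hC : -1 ≤ C := by linarith
    obtain ⟨rfl, rfl⟩ := eq_one_of_le_two hi hj (by nlinarith [sq_nonneg (i - j)]) (by nlinarith)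
    obtain ⟨rfl, rfl⟩ := eq_one_of_le_two hi' hj' (by nlinarith [sq_nonneg (i' - j')]) (by nlinarith)
    linarith
  · obtain ⟨D, rfl⟩ := hBC rfl
    have hD : -1 ≤ D := by omega
    rcases hD.eq_or_lt with rfl | hD
    · obtain ⟨h1, rfl⟩ := eq_one_or_two_of_le_two hi hj (by nlinarith)
      obtain ⟨h2, rfl⟩ := eq_one_or_two_of_le_two hi' hj' (by nlinarith)
      rcases h1 with rfl | rfl <;> rcases h2 with rfl | rfl <;> norm_num
    · have : 0 ≤ D := by omega
      nlinarith
  · obtain ⟨D, rfl⟩ := hAC rfl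
    have hD : -1 ≤ D := by omega
    rcases hD.eq_or_lt with rfl | hD
    · obtain ⟨h1, rfl⟩ := eq_one_or_two_of_le_two hj hi (by nlinarith)
      obtain ⟨h2, rfl⟩ := eq_one_or_two_of_le_two hj' hi' (by nlinarith)
      rcases h1 with rfl | rfl <;> rcases h2 with rfl | rfl <;> norm_num
    · have : 0 ≤ D := by omega
      nlinarith
  · obtain ⟨D, rfl⟩ := hABC rfl rfl
    have : 0 ≤ D := by omega
    nlinarith

theorem norm_comb (r p : Root n) (i j : ℕ) :
    (i • r.wt + j • p.wt) ⬝ᵥ (i • r.wt + j • p.wt) =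
      r.wt ⬝ᵥ r.wt * (i : ℤ) ^ 2 + 2 * (r.wt ⬝ᵥ p.wt) * (i * j) + p.wt ⬝ᵥ p.wt * (j : ℤ) ^ 2 := by
  simp only [add_dotProduct, dotProduct_add, smul_dotProduct, dotProduct_smul]
  rw [dotProduct_comm p.wt r.wt]
  simp only [nsmul_eq_mul]
  ring

theorem Root.norm_wt_le (r : Root n) : r.wt ⬝ᵥ r.wt ≤ 4 := by
  rw [Root.wt_eq]; exact idxWt_sub_norm_le _ _

theorem Comb.norm_add_gt {r p : Root n} (h : r.wt + p.wt ≠ 0) (q q' : Comb r p) :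
    4 < (q.1.wt + q'.1.wt) ⬝ᵥ (q.1.wt + q'.1.wt) := by
  obtain ⟨q, i, j, hi, hj, hq⟩ := q
  obtain ⟨q', i', j', hi', hj', hq'⟩ := q'
  have n1 := q.norm_wt_le
  have n2 := q'.norm_wt_le
  have e1 : q.wt + q'.wt = (i + i') • r.wt + (j + j') • p.wt := by
    rw [hq, hq', add_smul, add_smul]; abel
  simp only
  rw [e1, norm_comb]
  rw [hq, norm_comb] at n1
  rw [hq', norm_comb] at n2
  push_cast
  have even : ∀ {r p : Root n}, r.wt ⬝ᵥ r.wt = 4 → (2 : ℤ) ∣ r.wt ⬝ᵥ p.wt := by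
    intro r p h4
    rcases r.norm_wt with h | ⟨-, h⟩
    · omega
    · exact ⟨idxWt r.pos.1 ⬝ᵥ p.wt, by rw [h, smul_dotProduct]; simp⟩
  refine quadForm_sum_gt (r.norm_wt.imp_right And.left) (p.norm_wt.imp_right And.left) even
    (fun h => dotProduct_comm r.wt p.wt ▸ even h) ?_ (Root.norm_add_pos h) (by exact_mod_cast hi)
    (by exact_mod_cast hj) (by exact_mod_cast hi') (by exact_mod_cast hj') n1 n2
  intro hr hp
  rcases r.norm_wt with h | ⟨-, h⟩
  · omega
  rcases p.norm_wt with h' | ⟨-, h'⟩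
  · omega
  refine ⟨idxWt r.pos.1 ⬝ᵥ idxWt p.pos.1, ?_⟩
  rw [h, h', smul_dotProduct, dotProduct_smul]
  simp; ring

end SLRel

/-! ### Root vectors as weight vectors, and the commutator formula. -/

namespace SLRel

open scoped commutatorElement

variable {n : ℕ} {K : Type*}

section field

variable [Field K]

/-- The parameter of `r` read off from the entries of a matrix. -/
def coord (r : Root n) (M : Matrix (Fin n ⊕ Fin n) (Fin n ⊕ Fin n) K) : r.params K :=
  ⟨(M r.pos.1 r.pos.2, if r.pos.2 = r.pos.1.swap then 0 else M r.pos.2.swap r.pos.1.swap), by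
    cases r <;> simp [Root.params, Root.pos, AddSubgroup.mem_prod]⟩

theorem coord_add (r : Root n) (M N : Matrix (Fin n ⊕ Fin n) (Fin n ⊕ Fin n) K) :
    coord r (M + N) = coord r M + coord r N := by
  ext <;> simp [coord]
  split_ifs <;> simp

theorem coord_zero (r : Root n) :
    coord r (0 : Matrix (Fin n ⊕ Fin n) (Fin n ⊕ Fin n) K) = 0 := by
  ext <;> simp [coord]

theorem coord_sum {α : Type*} (r : Root n) (s : Finset α)
    (M : α → Matrix (Fin n ⊕ Fin n) (Fin n ⊕ Fin n) K) :
    coord r (∑ x ∈ s, M x) = ∑ x ∈ s, coord r (M x) :=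
  map_sum (⟨⟨coord r, coord_zero r⟩, coord_add r⟩ :
    Matrix (Fin n ⊕ Fin n) (Fin n ⊕ Fin n) K →+ r.params K) M s

theorem rootVec_eq (r : Root n) (t : K × K) :
    rootVec r t = Matrix.single r.pos.1 r.pos.2 t.1 +
      if r.pos.2 = r.pos.1.swap then 0 else Matrix.single r.pos.2.swap r.pos.1.swap t.2 := by
  cases r with
  | sub i j h => simp [rootVec, Root.pos]
  | add i j h => simp [rootVec, Root.pos, h.ne']
  | negAdd i j h => simp [rootVec, Root.pos, h.ne]
  | long i => simp [rootVec, Root.pos]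
  | negLong i => simp [rootVec, Root.pos]

theorem rootVec_supp {r : Root n} {t : K × K} {a b : Fin n ⊕ Fin n} (h : rootVec r t a b ≠ 0) :
    idxWt a - idxWt b = r.wt := by
  rw [Root.wt_eq]
  rw [rootVec_eq, Matrix.add_apply] at h
  by_cases h1 : r.pos.1 = a ∧ r.pos.2 = b
  · rw [h1.1, h1.2]
  rw [Matrix.single_apply_of_ne _ _ _ _ _ h1, zero_add] at h
  split_ifs at h with h2
  · simp at h
  by_cases h3 : r.pos.2.swap = a ∧ r.pos.1.swap = b
  · rw [← h3.1, ← h3.2, idxWt_swap, idxWt_swap]; abel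
  · rw [Matrix.single_apply_of_ne _ _ _ _ _ h3] at h
    exact absurd rfl h

theorem rootVec_coord_apply {r : Root n} (M : Matrix (Fin n ⊕ Fin n) (Fin n ⊕ Fin n) K)
    {a b : Fin n ⊕ Fin n} (h : idxWt a - idxWt b = r.wt) :
    rootVec r (coord r M).1 a b = M a b := by
  have hab : a ≠ b := by
    rintro rfl
    exact r.wt_ne_zero (by rw [← h, sub_self])
  rw [Root.wt_eq] at h
  rw [rootVec_eq, Matrix.add_apply]
  by_cases hsw : r.pos.2 = r.pos.1.swap
  · have : r.pos.1 = a ∧ r.pos.2 = b := by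
      rcases idxWt_sub_eq hab h with ⟨rfl, rfl⟩ | ⟨rfl, rfl⟩
      · exact ⟨rfl, rfl⟩
      · exact ⟨by rw [hsw, Sum.swap_swap], hsw⟩
    obtain ⟨rfl, rfl⟩ := this
    rw [if_pos hsw]
    simp [coord]
  · have hsw' : r.pos.1 ≠ r.pos.2.swap := fun h => hsw (by rw [h, Sum.swap_swap])
    rw [if_neg hsw]
    rcases idxWt_sub_eq hab h with ⟨rfl, rfl⟩ | ⟨rfl, rfl⟩
    · rw [Matrix.single_apply_of_ne _ _ _ _ _ (fun h => hsw' h.1.symm)]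
      simp [coord]
    · rw [Matrix.single_apply_of_ne _ _ _ _ _ (fun h => hsw' h.1)]
      simp [coord, hsw]

theorem coord_rootVec (r : Root n) (a : r.params K) : coord r (rootVec r a.1) = a := by
  have hsw : r.pos.2 ≠ r.pos.1.swap → r.pos.1 ≠ r.pos.2.swap :=
    fun h h' => h (by rw [h', Sum.swap_swap])
  obtain ⟨⟨s, t⟩, h⟩ := a
  ext
  · simp only [coord, rootVec_eq]
    split_ifs with h1
    · simp
    · rw [Matrix.add_apply, Matrix.single_apply_of_ne _ _ _ _ _ (fun h => hsw h1 h.1.symm)]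
      simp
  · simp only [coord]
    split_ifs with h1
    · cases r <;> simp_all [Root.pos, Root.params, AddSubgroup.mem_prod] <;>
        (exfalso; omega)
    · simp only [rootVec_eq]
      rw [if_neg h1, Matrix.add_apply,
        Matrix.single_apply_of_ne _ _ _ _ _ (fun h => hsw h1 h.1)]
      simp

theorem coord_rootVec_of_ne {r p : Root n} (h : r ≠ p) (t : K × K) :
    coord r (rootVec p t) = 0 := by
  have key : ∀ a b : Fin n ⊕ Fin n, idxWt a - idxWt b = r.wt → rootVec p t a b = 0 := by
    intro a b hab
    by_contra h0
    exact h (Root.wt_injective (hab.symm.trans (rootVec_supp h0)))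
  ext
  · exact key _ _ r.wt_eq.symm
  · simp only [coord]
    split_ifs
    · rfl
    · exact key _ _ (by rw [Root.wt_eq, idxWt_swap, idxWt_swap]; abel)

/-- `M` is a weight vector of weight `μ`. -/
def HasWt (M : Matrix (Fin n ⊕ Fin n) (Fin n ⊕ Fin n) K) (μ : Fin n → ℤ) : Prop :=
  ∀ a b, M a b ≠ 0 → idxWt a - idxWt b = μ

theorem hasWt_rootVec (r : Root n) (t : K × K) : HasWt (rootVec r t) r.wt :=
  fun _ _ h => rootVec_supp h

theorem HasWt.mul {M N : Matrix (Fin n ⊕ Fin n) (Fin n ⊕ Fin n) K} {μ ν : Fin n → ℤ}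
    (hM : HasWt M μ) (hN : HasWt N ν) : HasWt (M * N) (μ + ν) := by
  intro a c h
  rw [Matrix.mul_apply] at h
  obtain ⟨b, -, hb⟩ := Finset.exists_ne_zero_of_sum_ne_zero h
  rw [← hM a b (left_ne_zero_of_mul hb), ← hN b c (right_ne_zero_of_mul hb)]
  abel

theorem HasWt.eq_zero {M : Matrix (Fin n ⊕ Fin n) (Fin n ⊕ Fin n) K} {μ : Fin n → ℤ}
    (hM : HasWt M μ) (hμ : 4 < μ ⬝ᵥ μ) : M = 0 := by
  ext a b
  by_contra h
  rw [← hM a b h] at hμ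
  exact absurd (idxWt_sub_norm_le a b) (not_le.2 hμ)

theorem HasWt.exists_root {M : Matrix (Fin n ⊕ Fin n) (Fin n ⊕ Fin n) K} {μ : Fin n → ℤ}
    (hM : HasWt M μ) (hμ : μ ≠ 0) {a b : Fin n ⊕ Fin n} (h : M a b ≠ 0) :
    ∃ q : Root n, q.wt = μ ∧ idxWt a - idxWt b = q.wt := by
  have h1 := hM a b h
  have hab : a ≠ b := by
    rintro rfl
    exact hμ (by rw [← h1, sub_self])
  obtain ⟨q, hq⟩ := SLRel.exists_root hab
  exact ⟨q, hq.trans h1, hq.symm⟩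

theorem rootVec_coord_single {r : Root n} {a b : Fin n ⊕ Fin n} (h : r.wt = idxWt a - idxWt b)
    (t : K) : rootVec r (coord r (Matrix.single a b t)).1 = Matrix.single a b t := by
  ext a' b'
  by_cases h' : idxWt a' - idxWt b' = r.wt
  · exact rootVec_coord_apply _ h'
  · have h1 : rootVec r (coord r (Matrix.single a b t)).1 a' b' = 0 := by
      by_contra h0
      exact h' (rootVec_supp h0)
    rw [h1, Matrix.single_apply_of_ne]
    rintro ⟨rfl, rfl⟩
    exact h' h.symm

theorem rootVec_mul_rootVec_self (r : Root n) (s t : K × K) : rootVec r s * rootVec r t = 0 := by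
  refine ((hasWt_rootVec r s).mul (hasWt_rootVec r t)).eq_zero ?_
  have : r.wt + r.wt = 2 • r.wt := (two_nsmul _).symm
  rw [this, smul_dotProduct, dotProduct_smul]
  rcases r.norm_wt with h | ⟨h, -⟩ <;> rw [h] <;> norm_num

theorem rootVec_add (r : Root n) (s t : K × K) : rootVec r (s + t) = rootVec r s + rootVec r t := by
  cases r <;> simp [rootVec, Matrix.single_add] <;> abel

theorem rootVec_zero (r : Root n) : rootVec r (0 : K × K) = 0 := by
  cases r <;> simp [rootVec]

end field

variable [RCLike K]

theorem coe_rootElt (r : Root n) (a : r.params K) :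
    (rootElt r a : Matrix (Fin n ⊕ Fin n) (Fin n ⊕ Fin n) K) = 1 + rootVec r a.1 :=
  exp_rootVec r a.1

theorem rootElt_add (r : Root n) (a b : r.params K) :
    rootElt r (a + b) = rootElt r a * rootElt r b := by
  apply Subtype.ext
  rw [Matrix.SpecialLinearGroup.coe_mul, coe_rootElt, coe_rootElt, coe_rootElt,
    AddSubgroup.coe_add, rootVec_add, add_mul, mul_add (rootVec _ _), rootVec_mul_rootVec_self]
  simp only [one_mul, mul_one, add_zero]
  abel

theorem rootElt_zero (r : Root n) : rootElt r (0 : r.params K) = 1 := by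
  have := rootElt_add r (0 : r.params K) 0
  simpa using this

theorem coe_rootElt_inv (r : Root n) (a : r.params K) :
    ((rootElt r a)⁻¹ : Matrix.SpecialLinearGroup (Fin n ⊕ Fin n) K).1 = 1 - rootVec r a.1 := by
  have h : (rootElt r a)⁻¹ = rootElt r (-a) := by
    rw [inv_eq_iff_mul_eq_one, ← rootElt_add, add_neg_cancel, rootElt_zero]
  have h2 : rootVec r (-a.1) = - rootVec r a.1 := by
    rw [eq_neg_iff_add_eq_zero, ← rootVec_add, neg_add_cancel, rootVec_zero]
  rw [h, coe_rootElt, AddSubgroup.coe_neg, h2, sub_eq_add_neg]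

/-- Since both root vectors have square zero, the inverses are `1 - R` and `1 - P`, and only
alternating words survive the expansion. -/
theorem coe_commutator (r p : Root n) (a : r.params K) (b : p.params K) :
    (⁅rootElt r a, rootElt p b⁆ : Matrix.SpecialLinearGroup (Fin n ⊕ Fin n) K).1 =
      1 + (rootVec r a.1 * rootVec p b.1 - rootVec p b.1 * rootVec r a.1
        - rootVec r a.1 * rootVec p b.1 * rootVec r a.1
        + rootVec p b.1 * rootVec r a.1 * rootVec p b.1
        + rootVec r a.1 * rootVec p b.1 * (rootVec r a.1 * rootVec p b.1)) := by
  have hr := rootVec_mul_rootVec_self r a.1 a.1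
  have hp := rootVec_mul_rootVec_self p b.1 b.1
  rw [commutatorElement_def, Matrix.SpecialLinearGroup.coe_mul, Matrix.SpecialLinearGroup.coe_mul,
    Matrix.SpecialLinearGroup.coe_mul, coe_rootElt_inv, coe_rootElt_inv, coe_rootElt, coe_rootElt]
  set R := rootVec r a.1
  set P := rootVec p b.1
  simp only [mul_add, add_mul, mul_sub, sub_mul, mul_one, one_mul, mul_assoc, hr, hp, mul_zero,
    zero_mul]
  abel

/-- The alternating words have weights `r + p`, `2r + p`, `r + 2p` and `2r + 2p`. None of these is
zero: for instance `p = -2r` would have norm at least 8. So a nonzero entry of a word makes its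
weight a root. -/
theorem exists_comb_of_commutator_ne {r p : Root n} (h : r.wt + p.wt ≠ 0) {a : r.params K}
    {b : p.params K} {i j : Fin n ⊕ Fin n}
    (hij : ((⁅rootElt r a, rootElt p b⁆ : Matrix.SpecialLinearGroup (Fin n ⊕ Fin n) K).1 - 1) i j
      ≠ 0) : ∃ q : Comb r p, idxWt i - idxWt j = q.1.wt := by
  have wr := hasWt_rootVec r a.1
  have wp := hasWt_rootVec p b.1
  rw [coe_commutator, add_sub_cancel_left] at hij
  set R := rootVec r a.1
  set P := rootVec p b.1
  have ne2 : ∀ {r p : Root n}, r.wt + p.wt + r.wt ≠ 0 := by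
    intro r p h0
    have h1 : p.wt = -(2 • r.wt) := by
      rw [two_nsmul, ← sub_eq_zero, ← h0]; abel
    have h2 := p.norm_wt_le
    rw [h1, neg_dotProduct_neg, smul_dotProduct, dotProduct_smul] at h2
    rcases r.norm_wt with h | ⟨h, -⟩ <;> rw [h] at h2 <;> norm_num at h2
  by_cases h1 : (R * P) i j = 0
  swap
  · obtain ⟨q, hq, hq'⟩ := (wr.mul wp).exists_root h h1
    exact ⟨⟨q, 1, 1, one_pos, one_pos, by simp [hq]⟩, hq'⟩
  by_cases h2 : (P * R) i j = 0
  swap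
  · obtain ⟨q, hq, hq'⟩ := (wp.mul wr).exists_root (by rwa [add_comm]) h2
    exact ⟨⟨q, 1, 1, one_pos, one_pos, by simp [hq, add_comm]⟩, hq'⟩
  by_cases h3 : (R * P * R) i j = 0
  swap
  · obtain ⟨q, hq, hq'⟩ := ((wr.mul wp).mul wr).exists_root ne2 h3
    exact ⟨⟨q, 2, 1, two_pos, one_pos, by rw [hq, two_nsmul, one_nsmul]; abel⟩, hq'⟩
  by_cases h4 : (P * R * P) i j = 0
  swap
  · obtain ⟨q, hq, hq'⟩ := ((wp.mul wr).mul wp).exists_root ne2 h4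
    exact ⟨⟨q, 1, 2, one_pos, two_pos, by rw [hq, two_nsmul, one_nsmul]; abel⟩, hq'⟩
  by_cases h5 : (R * P * (R * P)) i j = 0
  swap
  · have hne : r.wt + p.wt + (r.wt + p.wt) ≠ 0 := by
      rw [← two_nsmul]
      exact smul_ne_zero two_ne_zero h
    obtain ⟨q, hq, hq'⟩ := ((wr.mul wp).mul (wr.mul wp)).exists_root hne h5
    exact ⟨⟨q, 2, 2, two_pos, two_pos, by rw [hq, two_nsmul, two_nsmul]; abel⟩, hq'⟩
  · simp [h1, h2, h3, h4, h5] at hij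

/-- All products of two root vectors occurring here have weight of norm greater than 4 and vanish.
The sum on the right does not depend on the order, which is why any order of factors is allowed. -/
theorem coe_prod_rootElt {r p : Root n} (h : r.wt + p.wt ≠ 0) (l : List (Comb r p))
    (f : ∀ q : Comb r p, q.1.params K) :
    ((l.map fun q => rootElt q.1 (f q)).prod : Matrix.SpecialLinearGroup (Fin n ⊕ Fin n) K).1 =
      1 + (l.map fun q => rootVec q.1 (f q).1).sum := by
  induction l with
  | nil => simp
  | cons q l ih =>
    have hz : rootVec q.1 (f q).1 * (l.map fun q => rootVec q.1 (f q).1).sum = 0 := by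
      clear ih
      induction l with
      | nil => simp
      | cons q' l ih =>
        rw [List.map_cons, List.sum_cons, mul_add, ih, add_zero]
        exact ((hasWt_rootVec _ _).mul (hasWt_rootVec _ _)).eq_zero (Comb.norm_add_gt h q q')
    rw [List.map_cons, List.prod_cons, List.map_cons, List.sum_cons,
      Matrix.SpecialLinearGroup.coe_mul, ih, coe_rootElt, add_mul, one_mul,
      mul_add (rootVec _ _), hz, mul_one, add_zero]
    abel

theorem coord_prod_rootElt {r p : Root n} (h : r.wt + p.wt ≠ 0) {l : List (Comb r p)}
    (hl : l.Nodup) (hc : ∀ q, q ∈ l) (f : ∀ q : Comb r p, q.1.params K) (q : Comb r p) :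
    coord q.1 (((l.map fun q => rootElt q.1 (f q)).prod :
      Matrix.SpecialLinearGroup (Fin n ⊕ Fin n) K).1 - 1) = f q := by
  classical
  rw [coe_prod_rootElt h, add_sub_cancel_left, ← List.sum_toFinset _ hl, coord_sum,
    Finset.sum_eq_single q, coord_rootVec]
  · intro q' _ hne
    exact coord_rootVec_of_ne (fun h => hne (Subtype.ext h.symm)) _
  · intro hq
    exact absurd (List.mem_toFinset.2 (hc q)) hq

/-- The functions in the commutator formulas. -/
noncomputable def commFun (n : ℕ) (K : Type*) [RCLike K] : CommFun n K := fun _ _ _ q a b =>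
  coord q.1 (⁅rootElt _ a, rootElt _ b⁆.1 - 1)

theorem commFormula_iff (ord : FactorOrder n) (g : CommFun n K) :
    CommFormula ord g ↔ g = commFun n K := by
  constructor
  · intro hg
    funext r p h q a b
    rw [commFun, hg r p h a b, coord_prod_rootElt h (ord.nodup r p) (ord.complete r p)]
  · rintro rfl r p h a b
    classical
    apply Subtype.ext
    rw [coe_prod_rootElt h, ← List.sum_toFinset _ (ord.nodup r p), ← sub_eq_iff_eq_add']
    ext i j
    rw [Matrix.sum_apply]
    by_cases hq : ∃ q : Comb r p, idxWt i - idxWt j = q.1.wt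
    · obtain ⟨q, hq⟩ := hq
      rw [Finset.sum_eq_single q]
      · exact (rootVec_coord_apply _ hq).symm
      · intro q' _ hne
        by_contra h0
        exact hne (Subtype.ext (Root.wt_injective ((rootVec_supp h0).symm.trans hq)))
      · intro hq'
        exact absurd (List.mem_toFinset.2 (ord.complete r p q)) hq'
    · rw [Finset.sum_eq_zero]
      · by_contra h0
        exact hq (exists_comb_of_commutator_ne h h0)
      · intro q' _
        by_contra h0
        exact hq ⟨q', rootVec_supp h0⟩

end SLRel

/-! ### Commutation of elementary elements in opposite root groups. -/

namespace Steinberg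

open scoped commutatorElement

/-- A Steinberg relation for disjoint pairs of indices that follows from the other ones. -/
theorem commute_of_relations {ι K G : Type*} [Field K] [Group G] {e : ι → ι → K → G}
    (h2 : (2 : K) ≠ 0) {a b c d : ι} (hab : a ≠ b) (hac : a ≠ c) (had : a ≠ d) (hbc : b ≠ c)
    (hbd : b ≠ d) (hcd : c ≠ d)
    (add : ∀ {i j}, i ≠ j → ∀ s t, e i j (s + t) = e i j s * e i j t)
    (mul : ∀ {i j k}, i ≠ j → j ≠ k → i ≠ k → ∀ s t, ⁅e i j s, e j k t⁆ = e i k (s * t))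
    (ab_ad : ∀ s t, Commute (e a b s) (e a d t)) (cd_ad : ∀ s t, Commute (e c d s) (e a d t))
    (ab_cb : ∀ s t, Commute (e a b s) (e c b t)) (cd_cb : ∀ s t, Commute (e c d s) (e c b t))
    (ab_db : ∀ s t, Commute (e a b s) (e d b t)) (s t : K) :
    Commute (e a b s) (e c d t) := by
  have zero : ∀ {i j}, i ≠ j → e i j 0 = 1 := fun hij => by simpa using add hij 0 0
  have swap : ∀ {i j k}, i ≠ j → j ≠ k → i ≠ k → ∀ s t,
      SemiconjBy (e i j s) (e j k t) (e i k (s * t) * e j k t) := by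
    intro i j k hij hjk hik s t
    rw [SemiconjBy, ← mul hij hjk hik]
    simp [commutatorElement_def, mul_assoc]
  obtain ⟨C, hC⟩ : ∃ C : K → K → G, ∀ s t, C s t = ⁅e a b s, e c d t⁆ := ⟨_, fun _ _ => rfl⟩
  have comm_C : ∀ s t z, Commute (e a b s) z → Commute (e c d t) z → Commute (C s t) z := by
    intro s t z h1 h2
    rw [hC, commutatorElement_def]
    exact ((h1.mul_left h2).mul_left h1.inv_left).mul_left h2.inv_left
  have C_ad : ∀ s t x, Commute (C s t) (e a d x) := fun s t x =>
    comm_C s t _ (ab_ad _ _) (cd_ad _ _)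
  have C_cb : ∀ s t x, Commute (C s t) (e c b x) := fun s t x =>
    comm_C s t _ (ab_cb _ _) (cd_cb _ _)
  -- Conjugation by `e a b s` is trivial on `e c b` and `e d b`, which `e c d t` maps into the group
  -- they generate; so the commutator acts trivially there.
  have C_db : ∀ s t x, Commute (C s t) (e d b x) := by
    intro s t x
    have h1 := swap hcd hbd.symm hbc.symm t x
    have h3 : SemiconjBy (C s t) (e c b (t * x) * e d b x) (e c b (t * x) * e d b x) := by
      rw [hC, commutatorElement_def]
      exact (((show SemiconjBy (e a b s) _ _ from (ab_cb s _).mul_right (ab_db s _)).mul_left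
        h1).mul_left (ab_db s x).inv_left).mul_left h1.inv_symm_left
    have h4 := (C_cb s t (t * x)).inv_right.mul_right h3
    rwa [inv_mul_cancel_left] at h4
  -- Because `e a b` is a commutator of `e a d` and `e d b`. This gives additivity of `C` in its
  -- first argument.
  have C_ab : ∀ s t x, Commute (C s t) (e a b x) := by
    intro s t x
    have := semiconjBy_commutator (C_ad s t x) (C_db s t 1)
    rwa [mul had hbd.symm hab, mul_one] at this
  have C_add : ∀ s s' t, C (s + s') t = C s' t * C s t := by
    intro s s' t
    have : C (s + s') t = e a b s * C s' t * (e a b s)⁻¹ * C s t := by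
      rw [hC, hC, hC, add hab]
      simp [commutatorElement_def, mul_assoc]
    rw [this, ← (C_ab s' t s).eq, mul_inv_cancel_right]
  -- Write `e c d t = ⁅e c b t, e b d 1⁆` and conjugate by `e a b s`.
  have C_eq : ∀ s t, C s t = ⁅e c b t, e a d s⁆ := by
    intro s t
    have h1 : SemiconjBy (e a b s) (e c d t) (⁅e c b t, e a d s * e b d 1⁆) := by
      have := semiconjBy_commutator (ab_cb s t) (swap hab hbd had s 1)
      rwa [mul hbc.symm hbd hcd, mul_one, mul_one] at this
    have h3 : ⁅e c b t, e a d s * e b d 1⁆ = ⁅e c b t, e a d s⁆ * e c d t := by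
      have : ⁅e c b t, e a d s * e b d 1⁆ =
          ⁅e c b t, e a d s⁆ * (e a d s * ⁅e c b t, e b d 1⁆ * (e a d s)⁻¹) := by
        simp [commutatorElement_def, mul_assoc]
      rw [this, mul hbc.symm hbd hcd, mul_one, ← (cd_ad t s).eq, mul_inv_cancel_right]
    rw [h3] at h1
    rw [hC, commutatorElement_def, h1.eq]
    simp [mul_assoc]
  -- Write `e a d s = ⁅e a c s, e c d 1⁆` and conjugate by `e c b t`.
  have C_eq' : ∀ s t, C s t = C (-(s * t)) 1 := by
    intro s t
    have h1 : SemiconjBy (e c b t) (e a c s) (e a b (-(s * t)) * e a c s) := by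
      have h5 := (swap hac hbc.symm hab s t).eq
      have h6 : e a b (-(s * t)) = (e a b (s * t))⁻¹ := by
        rw [eq_inv_iff_mul_eq_one, ← add hab, neg_add_cancel, zero hab]
      rw [SemiconjBy, h6, mul_assoc, h5]
      simp [mul_assoc]
    have h3 := semiconjBy_commutator h1 (cd_cb 1 t).symm
    rw [mul hac hcd had, mul_one] at h3
    have h4 : ⁅e a b (-(s * t)) * e a c s, e c d 1⁆ = C (-(s * t)) 1 * e a d s := by
      have : ⁅e a b (-(s * t)) * e a c s, e c d 1⁆ = e a b (-(s * t)) * ⁅e a c s, e c d 1⁆ *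
          (e a b (-(s * t)))⁻¹ * C (-(s * t)) 1 := by
        rw [hC]
        simp [commutatorElement_def, mul_assoc]
      rw [this, mul hac hcd had, mul_one, (ab_ad _ s).eq, mul_inv_cancel_right,
        (C_ad _ _ s).eq]
    rw [h4] at h3
    rw [C_eq, commutatorElement_def, h3.eq]
    simp [mul_assoc]
  have C_zero : ∀ t, C 0 t = 1 := fun t => by rw [hC, zero hab, commutatorElement_one_left]
  -- At `t = 1` the last identity reads `C s 1 = C (-s) 1`, so by additivity every `C x 1` squares
  -- to 1; halving `s` concludes.
  have C_one : ∀ s, C s 1 = 1 := by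
    intro s
    have h1 : ∀ x, C x 1 * C x 1 = 1 := by
      intro x
      have h3 := C_eq' x 1
      rw [mul_one] at h3
      nth_rw 1 [h3]
      rw [← C_add, add_neg_cancel, C_zero]
    rw [← h1 (s / 2), ← C_add]
    congr 1
    field_simp
    ring
  rw [← commutatorElement_eq_one_iff_commute, ← hC, C_eq', C_one]

end Steinberg

/-! ### From the root relations to the Steinberg relations. -/

namespace SLRel

open scoped commutatorElement

variable {n : ℕ} {K G : Type*} [RCLike K] [Group G]

theorem prod_map_eq_single {α M : Type*} [Monoid M] {l : List α} (hl : l.Nodup) {a : α} (ha : a ∈ l)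
    {f : α → M} (hf : ∀ b, b ≠ a → f b = 1) : (l.map f).prod = f a := by
  classical
  rw [List.prod_map_eq_pow_single a f (fun b hb _ => hf b hb), List.count_eq_one_of_mem hl ha,
    pow_one]

/-- A family of elements of a group that satisfies the additivity and the commutator relations. -/
structure IsRootFamily (ord : FactorOrder n) (x : ∀ r : Root n, r.params K → G) : Prop where
  add : ∀ r a b, x r a * x r b = x r (a + b)
  comm : ∀ r p (h : r.wt + p.wt ≠ 0) a b, ⁅x r a, x p b⁆ =
    ((ord.list r p).map fun q => x q.1 (commFun n K r p h q a b)).prod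

open Classical in
/-- The elementary element in position `(a, b)`. -/
noncomputable def elem (x : ∀ r : Root n, r.params K → G) (a b : Fin n ⊕ Fin n) (t : K) : G :=
  if h : a ≠ b then x (exists_root h).choose (coord _ (Matrix.single a b t)) else 1

theorem elem_eq (x : ∀ r : Root n, r.params K → G) {a b : Fin n ⊕ Fin n} {r : Root n}
    (h : r.wt = idxWt a - idxWt b) (t : K) : elem x a b t = x r (coord r (Matrix.single a b t)) := by
  have hab : a ≠ b := by
    rintro rfl
    exact r.wt_ne_zero (by rw [h, sub_self])
  rw [elem, dif_pos hab]
  have : (exists_root hab).choose = r :=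
    Root.wt_injective ((exists_root hab).choose_spec.trans h.symm)
  rw [this]

theorem coe_rootElt_coord_single {a b : Fin n ⊕ Fin n} {r : Root n}
    (h : r.wt = idxWt a - idxWt b) (t : K) :
    (rootElt r (coord r (Matrix.single a b t))).1 = Matrix.transvection a b t := by
  rw [coe_rootElt, rootVec_coord_single h, Matrix.transvection]

namespace IsRootFamily

variable {ord : FactorOrder n} {x : ∀ r : Root n, r.params K → G} (hx : IsRootFamily ord x)
include hx

theorem zero (r : Root n) : x r 0 = 1 := by
  simpa using hx.add r 0 0

/-- The parameters on the right of a commutator relation are computed in `SL(2n, K)`. If the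
commutator is trivial there, they all vanish; if it is a single root element, one factor survives.
Such identities therefore lift to the abstract group. -/
theorem commute {r p : Root n} (h : r.wt + p.wt ≠ 0) {a : r.params K} {b : p.params K}
    (hab : Commute (rootElt r a) (rootElt p b)) : Commute (x r a) (x p b) := by
  rw [← commutatorElement_eq_one_iff_commute] at hab ⊢
  rw [hx.comm r p h, List.prod_eq_one]
  intro y hy
  obtain ⟨q, -, rfl⟩ := List.mem_map.1 hy
  rw [commFun, hab, Matrix.SpecialLinearGroup.coe_one, sub_self, coord_zero, hx.zero]

theorem commutator_eq {r p : Root n} (h : r.wt + p.wt ≠ 0) {a : r.params K} {b : p.params K}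
    (s : Comb r p) {c : s.1.params K} (hab : ⁅rootElt r a, rootElt p b⁆ = rootElt s.1 c) :
    ⁅x r a, x p b⁆ = x s.1 c := by
  have hc : ∀ q, commFun n K r p h q a b = coord q.1 (rootVec s.1 c.1) := by
    intro q
    rw [commFun, hab, coe_rootElt, add_sub_cancel_left]
  rw [hx.comm r p h, prod_map_eq_single (ord.nodup r p) (ord.complete r p s), hc, coord_rootVec]
  intro q hq
  rw [hc, coord_rootVec_of_ne (fun h => hq (Subtype.ext h)), hx.zero]

theorem isSteinberg : Steinberg.IsSteinberg (elem x) := by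
  have hadd : ∀ {i j}, i ≠ j → ∀ s t, elem x i j (s + t) = elem x i j s * elem x i j t := by
    intro i j hij s t
    obtain ⟨r, hr⟩ := exists_root hij
    rw [elem_eq x hr, elem_eq x hr, elem_eq x hr, hx.add, ← coord_add, Matrix.single_add]
  have hmul : ∀ {i j k}, i ≠ j → j ≠ k → i ≠ k → ∀ s t,
      ⁅elem x i j s, elem x j k t⁆ = elem x i k (s * t) := by
    intro i j k hij hjk hik s t
    obtain ⟨r, hr⟩ := exists_root hij
    obtain ⟨p, hp⟩ := exists_root hjk
    obtain ⟨q, hq⟩ := exists_root hik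
    have hrpq : q.wt = r.wt + p.wt := by rw [hr, hp, hq]; abel
    rw [elem_eq x hr, elem_eq x hp, elem_eq x hq]
    refine hx.commutator_eq (hrpq ▸ q.wt_ne_zero) ⟨q, 1, 1, one_pos, one_pos, by simpa using hrpq⟩ ?_
    rw [commutatorElement_def, mul_inv_eq_iff_eq_mul, mul_inv_eq_iff_eq_mul]
    apply Subtype.ext
    simp only [Matrix.SpecialLinearGroup.coe_mul, coe_rootElt_coord_single hr,
      coe_rootElt_coord_single hp, coe_rootElt_coord_single hq, Matrix.transvection]
    simp [mul_add, add_mul, hjk.symm, hik.symm]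
    abel
  have hcomm : ∀ {i j k l}, i ≠ j → k ≠ l → j ≠ k → i ≠ l → ¬ (i = k.swap ∧ j = l.swap) →
      ∀ s t, Commute (elem x i j s) (elem x k l t) := by
    intro i j k l hij hkl hjk hil hsp s t
    obtain ⟨r, hr⟩ := exists_root hij
    obtain ⟨p, hp⟩ := exists_root hkl
    rw [elem_eq x hr, elem_eq x hp]
    refine hx.commute ?_ ?_
    · intro h0
      have : idxWt i - idxWt j = idxWt l - idxWt k := by
        rw [← hr, ← neg_sub, ← hp, eq_neg_iff_add_eq_zero, h0]
      rcases idxWt_sub_eq hij this with h | h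
      · exact hil h.1
      · exact hsp h
    · apply Subtype.ext
      simp only [Matrix.SpecialLinearGroup.coe_mul, coe_rootElt_coord_single hr,
        coe_rootElt_coord_single hp, Matrix.transvection]
      simp [mul_add, add_mul, hjk, hil.symm]
      abel
  refine ⟨hadd, ?_, hmul⟩
  intro i j k l hij hkl hjk hil s t
  -- Exactly in this case the two roots are opposite and no commutator relation is available. The
  -- auxiliary relations used instead involve pairs of roots that are not opposite.
  by_cases hsp : i = k.swap ∧ j = l.swap
  swap
  · exact hcomm hij hkl hjk hil hsp s t
  obtain ⟨h1, h2⟩ := hsp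
  have hik : i ≠ k := h1 ▸ swap_ne k
  have hjl : j ≠ l := h2 ▸ swap_ne l
  refine Steinberg.commute_of_relations two_ne_zero hij hik hil hjk hjl hkl hadd hmul ?_ ?_ ?_ ?_ ?_
    s t
  · exact hcomm hij hil hij.symm hil fun h => swap_ne i h.1.symm
  · exact hcomm hkl hil hil.symm hkl fun h => swap_ne l h.2.symm
  · exact hcomm hij hjk.symm hjk hij fun h => swap_ne j h.2.symm
  · exact hcomm hkl hjk.symm hkl.symm hjk.symm fun h => swap_ne k h.1.symm
  · exact hcomm hij hjl.symm hjl hij fun h => swap_ne j h.2.symm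

end IsRootFamily

end SLRel

/-! ### The presentation and the kernel of the projection. -/

namespace SLRel

open scoped commutatorElement

variable {n : ℕ} {K G : Type*} [RCLike K] [Group G]

/-- The inclusion of `SL(2n, K)` in the monoid of matrices. -/
def slCoe (n : ℕ) (K : Type*) [Field K] : Matrix.SpecialLinearGroup (Fin n ⊕ Fin n) K →*
    Matrix (Fin n ⊕ Fin n) (Fin n ⊕ Fin n) K where
  toFun M := M.1
  map_one' := rfl
  map_mul' _ _ := rfl

theorem exists_third_index (hn : 2 ≤ n) (i j : Fin n ⊕ Fin n) : ∃ m, m ≠ i ∧ m ≠ j := by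
  have h : ({i, j} : Finset (Fin n ⊕ Fin n)).card < (Finset.univ : Finset (Fin n ⊕ Fin n)).card := by
    refine lt_of_le_of_lt Finset.card_le_two ?_
    simp
    omega
  obtain ⟨m, -, hm⟩ := Finset.exists_mem_notMem_of_card_lt_card h
  simp only [Finset.mem_insert, Finset.mem_singleton, not_or] at hm
  exact ⟨m, hm⟩

theorem commutator_rootElt_eq_one {r p : Root n} (h : r.wt + p.wt ≠ 0)
    (hq : ∀ q : Root n, q.wt ≠ r.wt + p.wt) (a : r.params K) (b : p.params K) :
    ⁅rootElt r a, rootElt p b⁆ = 1 := by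
  have h1 : rootVec r a.1 * rootVec p b.1 = 0 := by
    ext i j
    by_contra h0
    obtain ⟨q, hq', -⟩ := ((hasWt_rootVec r a.1).mul (hasWt_rootVec p b.1)).exists_root h h0
    exact hq q hq'
  have h2 : rootVec p b.1 * rootVec r a.1 = 0 := by
    ext i j
    by_contra h0
    obtain ⟨q, hq', -⟩ := ((hasWt_rootVec p b.1).mul (hasWt_rootVec r a.1)).exists_root
      (by rwa [add_comm]) h0
    exact hq q (hq'.trans (add_comm _ _))
  apply Subtype.ext
  rw [coe_commutator, h1, h2]
  simp

/-- The index of the first row. -/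
def fstIdx (hn : 2 ≤ n) : Fin n ⊕ Fin n := .inl ⟨0, by omega⟩

/-- The index of the second row. -/
def sndIdx (hn : 2 ≤ n) : Fin n ⊕ Fin n := .inl ⟨1, by omega⟩

theorem fstIdx_ne (hn : 2 ≤ n) : fstIdx hn ≠ sndIdx hn := by simp [fstIdx, sndIdx]

namespace IsRootFamily

variable {ord : FactorOrder n} {x : ∀ r : Root n, r.params K → G} (hx : IsRootFamily ord x)
include hx

/-- By additivity `x_r(a)` splits into elementary elements at the positions of its two coordinates,
the second being absent for a long root. Hence the elementary elements generate. -/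
theorem mem_block (r : Root n) (a : r.params K) :
    x r a ∈ Steinberg.block (elem x) fun _ _ => True := by
  have h1 := elem_eq x r.wt_eq a.1.1
  have hw : r.wt = idxWt r.pos.2.swap - idxWt r.pos.1.swap := by
    rw [Root.wt_eq, idxWt_swap, idxWt_swap]; abel
  have h2 := elem_eq x hw a.1.2
  have hne : r.pos.2.swap ≠ r.pos.1.swap := fun h => r.pos_ne (by
    rw [← Sum.swap_swap r.pos.1, ← h, Sum.swap_swap])
  rw [← coord_rootVec r a, rootVec_eq, coord_add, ← hx.add, ← h1]
  refine mul_mem (Steinberg.mem_block r.pos_ne trivial _) ?_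
  split_ifs
  · rw [coord_zero, hx.zero]
    exact one_mem _
  · rw [← h2]
    exact Steinberg.mem_block hne trivial _

variable (hn : 2 ≤ n) (hgen : Subgroup.closure {y | ∃ r a, y = x r a} = ⊤)
  {ψ : G →* Matrix.SpecialLinearGroup (Fin n ⊕ Fin n) K} (hψ : ∀ r a, ψ (x r a) = rootElt r a)

omit hx in
include hψ in
theorem map_elem {i j : Fin n ⊕ Fin n} (t : K) (hij : i ≠ j) :
    (slCoe n K).comp ψ (elem x i j t) = Matrix.transvection i j t := by
  obtain ⟨r, hr⟩ := exists_root hij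
  rw [elem_eq x hr, ← coe_rootElt_coord_single hr, MonoidHom.comp_apply, hψ]
  rfl

omit hx in
include hψ in
theorem surjective : Function.Surjective ψ := by
  intro M
  obtain ⟨g, hg⟩ := Steinberg.exists_map_eq (fun i j t hij => map_elem hψ t hij) M.2
  exact ⟨g, Subtype.ext hg⟩

include hn hgen hψ in
theorem ker_eq : ψ.ker = Subgroup.closure {y | ∃ u v : K, u ≠ 0 ∧ v ≠ 0 ∧
    y = Steinberg.h (elem x) (fstIdx hn) (sndIdx hn) u *
      Steinberg.h (elem x) (fstIdx hn) (sndIdx hn) v *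
      (Steinberg.h (elem x) (fstIdx hn) (sndIdx hn) (u * v))⁻¹} := by
  ext g
  rw [← hx.isSteinberg.map_eq_one_iff (exists_third_index hn)
    (fun i j t hij => map_elem hψ t hij) ?_ two_ne_zero (fstIdx_ne hn), MonoidHom.mem_ker]
  · exact ⟨fun h => congrArg Subtype.val h, fun h => Subtype.ext h⟩
  · rw [eq_top_iff, ← hgen, Subgroup.closure_le]
    rintro _ ⟨r, a, rfl⟩
    exact hx.mem_block r a

end IsRootFamily

theorem lift_h12 (hn : 2 ≤ n) (f : FreeGroup (Gen n K) →* G) (t : Kˣ) :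
    f (h12 hn t) = Steinberg.h (elem fun r a => f (X r a)) (fstIdx hn) (sndIdx hn) t := by
  have h1 : ∀ s, f (X (root12 hn) (par hn s)) =
      elem (fun r a => f (X r a)) (fstIdx hn) (sndIdx hn) s := by
    intro s
    rw [elem_eq _ (r := root12 hn) rfl]
    congr 2
  have h2 : ∀ s, f (X (root12 hn).neg (par' hn s)) =
      elem (fun r a => f (X r a)) (sndIdx hn) (fstIdx hn) s := by
    intro s
    rw [elem_eq _ (r := (root12 hn).neg) rfl]
    congr 2
  simp only [h12, map_mul, h1, h2, Steinberg.h, Steinberg.w, inv_neg, inv_one, neg_neg]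

theorem h12_eq_hWord (hn : 2 ≤ n) (t : Kˣ) : h12 hn t = hWord (root12 hn) (par hn (t : K)) := by
  have h1 : (⟨-((par hn (t : K)).1⁻¹), neg_inv_mem _ _⟩ : (root12 hn).neg.params K) =
      par' hn (-(t : K)⁻¹) := by
    ext <;> simp [par, par']
  have h2 : (⟨-((par hn (t : K)).1 * (par hn (t : K)).1⁻¹), neg_sign_mem _ _⟩ :
      (root12 hn).params K) = par hn (-1) := by
    ext <;> simp [par]
  have h3 : (⟨-((par hn (-1 : K)).1⁻¹), neg_inv_mem _ _⟩ : (root12 hn).neg.params K) =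
      par' hn 1 := by
    ext <;> simp [par, par', inv_neg]
  rw [hWord, wWord, h1, h2, wWord, h3, h12]

theorem isRootFamily_of {ord : FactorOrder n} {rels : Set (FreeGroup (Gen n K))}
    (h1 : addRels n K ⊆ rels) (h2 : commRels ord (commFun n K) ⊆ rels) :
    IsRootFamily ord fun (r : Root n) (a : r.params K) => PresentedGroup.mk rels (X r a) := by
  constructor
  · intro r a b
    have : PresentedGroup.mk rels (X r a * X r b * (X r (a + b))⁻¹) = 1 :=
      PresentedGroup.one_of_mem (h1 ⟨r, a, b, rfl⟩)
    rwa [map_mul, map_inv, mul_inv_eq_one, map_mul] at this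
  · intro r p h a b
    have := PresentedGroup.one_of_mem (h2 ⟨r, p, h, a, b, rfl⟩)
    rw [map_mul, map_inv, mul_inv_eq_one, map_commutatorElement, map_list_prod,
      List.map_map] at this
    exact this

theorem closure_gen_eq_top (rels : Set (FreeGroup (Gen n K))) :
    Subgroup.closure {y | ∃ (r : Root n) (a : r.params K), y = PresentedGroup.mk rels (X r a)}
      = ⊤ := by
  rw [eq_top_iff, ← PresentedGroup.closure_range_of rels, Subgroup.closure_le]
  rintro _ ⟨⟨r, a⟩, rfl⟩
  exact Subgroup.subset_closure ⟨r, a, rfl⟩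

theorem lift_rootElt_rels (ord : FactorOrder n) :
    ∀ w ∈ addRels n K ∪ commRels ord (commFun n K) ∪ trivialCommRels n K,
      FreeGroup.lift (fun y : Gen n K => rootElt y.1 y.2) w = 1 := by
  have hX : ∀ (r : Root n) (a : r.params K),
      FreeGroup.lift (fun y : Gen n K => rootElt y.1 y.2) (X r a) = rootElt r a :=
    fun r a => FreeGroup.lift_apply_of
  rintro w ((⟨r, a, b, rfl⟩ | ⟨r, p, h, a, b, rfl⟩) | ⟨r, p, a, b, h, hq, rfl⟩)
  · rw [map_mul, map_inv, mul_inv_eq_one, map_mul, hX, hX, hX, rootElt_add]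
  · rw [map_mul, map_inv, mul_inv_eq_one, map_commutatorElement, hX, hX, map_list_prod,
      List.map_map, (commFormula_iff ord _).2 rfl r p h a b]
    congr 2
    funext q
    exact (hX _ _).symm
  · rw [map_commutatorElement, hX, hX, commutator_rootElt_eq_one h hq]

theorem lift_rootElt_multRels (hn : 2 ≤ n) :
    ∀ w ∈ multRels K hn, FreeGroup.lift (fun y : Gen n K => rootElt y.1 y.2) w = 1 := by
  rintro w ⟨t₁, t₂, rfl⟩
  have hX : (fun (r : Root n) (a : r.params K) =>
      FreeGroup.lift (fun y : Gen n K => rootElt y.1 y.2) (X r a)) = rootElt := by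
    funext r a
    exact FreeGroup.lift_apply_of
  rw [map_mul, map_mul, map_inv, lift_h12, lift_h12, lift_h12, hX, Units.val_mul]
  exact Subtype.ext (Steinberg.IsSteinberg.map_symbol (φ := (slCoe n K).comp (MonoidHom.id _))
    (fun i j t hij => IsRootFamily.map_elem (fun _ _ => rfl) t hij) (fstIdx_ne hn) t₁.ne_zero
    t₂.ne_zero)

theorem mk_symbol (hn : 2 ≤ n) (rels : Set (FreeGroup (Gen n K))) (t₁ t₂ : Kˣ) :
    PresentedGroup.mk rels (h12 hn t₁ * h12 hn t₂ * (h12 hn (t₁ * t₂))⁻¹) =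
      Steinberg.h (elem fun r a => PresentedGroup.mk rels (X r a)) (fstIdx hn) (sndIdx hn) t₁ *
      Steinberg.h (elem fun r a => PresentedGroup.mk rels (X r a)) (fstIdx hn) (sndIdx hn) t₂ *
      (Steinberg.h (elem fun r a => PresentedGroup.mk rels (X r a)) (fstIdx hn) (sndIdx hn)
        (t₁ * t₂))⁻¹ := by
  rw [map_mul, map_mul, map_inv, lift_h12, lift_h12, lift_h12, Units.val_mul]

theorem par_ne_zero (hn : 2 ≤ n) (t : Kˣ) : par hn (t : K) ≠ 0 := by
  intro h0
  have h1 : (par hn (t : K)).1.1 = 0 := by rw [h0]; rfl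
  exact t.ne_zero h1

theorem symb_mem_HTilde (hn : 2 ≤ n) (ord : FactorOrder n) (g : CommFun n K) (t₁ t₂ : Kˣ) :
    symb hn ord g t₁ t₂ ∈ HTilde ord g := by
  have hmem : ∀ t : Kˣ, PresentedGroup.mk _ (h12 hn t) ∈ HTilde ord g := fun t =>
    Subgroup.subset_closure ⟨root12 hn, par hn t, par_ne_zero hn t, by rw [h12_eq_hWord]⟩
  rw [symb, map_mul, map_mul, map_inv]
  exact mul_mem (mul_mem (hmem _) (hmem _)) (inv_mem (hmem _))

end SLRel

theorem theorem4 {K : Type*} [RCLike K] {n : ℕ} (hn : 2 ≤ n) :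
    ∃ g : SLRel.CommFun n K,
      (∀ (ord : SLRel.FactorOrder n) (g' : SLRel.CommFun n K),
        SLRel.CommFormula ord g' ↔ g' = g) ∧
      ∀ ord : SLRel.FactorOrder n,
        (∃ e : PresentedGroup (SLRel.addRels n K ∪ SLRel.commRels ord g ∪
              SLRel.trivialCommRels n K ∪ SLRel.multRels K hn) ≃*
            Matrix.SpecialLinearGroup (Fin n ⊕ Fin n) K,
          ∀ (r : SLRel.Root n) (a : r.params K),
            e (PresentedGroup.of ⟨r, a⟩) = SLRel.rootElt r a) ∧
        ∃ π : SLRel.GTilde ord g →* Matrix.SpecialLinearGroup (Fin n ⊕ Fin n) K,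
          (∀ (r : SLRel.Root n) (a : r.params K),
            π (PresentedGroup.of ⟨r, a⟩) = SLRel.rootElt r a) ∧
          Function.Surjective π ∧
          π.ker ≤ SLRel.HTilde ord g ∧
          π.ker = Subgroup.closure
            {x | ∃ t₁ t₂ : Kˣ, x = SLRel.symb hn ord g t₁ t₂} := by
  refine ⟨SLRel.commFun n K, SLRel.commFormula_iff, fun ord => ⟨?_, ?_⟩⟩
  · set rels := SLRel.addRels n K ∪ SLRel.commRels ord (SLRel.commFun n K) ∪
      SLRel.trivialCommRels n K ∪ SLRel.multRels K hn with hrels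
    have hlift : ∀ w ∈ rels,
        FreeGroup.lift (fun y : SLRel.Gen n K => SLRel.rootElt y.1 y.2) w = 1 := by
      rintro w (hw | hw)
      · exact SLRel.lift_rootElt_rels ord w hw
      · exact SLRel.lift_rootElt_multRels hn w hw
    have hx : SLRel.IsRootFamily ord _ := SLRel.isRootFamily_of (rels := rels)
      (fun w hw => Or.inl (Or.inl (Or.inl hw))) (fun w hw => Or.inl (Or.inl (Or.inr hw)))
    have hψ : ∀ (r : SLRel.Root n) (a : r.params K), PresentedGroup.toGroup hlift
        (PresentedGroup.mk rels (SLRel.X r a)) = SLRel.rootElt r a :=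
      fun r a => PresentedGroup.toGroup.of hlift
    have hker := hx.ker_eq hn (SLRel.closure_gen_eq_top rels) hψ
    -- The symbols generating the kernel are relators of this group.
    have hbot : (PresentedGroup.toGroup hlift).ker = ⊥ := by
      rw [hker, Subgroup.closure_eq_bot_iff]
      rintro _ ⟨u, v, hu, hv, rfl⟩
      have := SLRel.mk_symbol hn rels (Units.mk0 u hu) (Units.mk0 v hv)
      rw [PresentedGroup.one_of_mem (Or.inr ⟨_, _, rfl⟩)] at this
      exact this.symm
    exact ⟨MulEquiv.ofBijective (PresentedGroup.toGroup hlift)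
      ⟨(MonoidHom.ker_eq_bot_iff _).1 hbot, SLRel.IsRootFamily.surjective hψ⟩, hψ⟩
  · set rels := SLRel.addRels n K ∪ SLRel.commRels ord (SLRel.commFun n K) ∪
      SLRel.trivialCommRels n K with hrels
    have hlift := SLRel.lift_rootElt_rels (K := K) ord
    have hx : SLRel.IsRootFamily ord _ := SLRel.isRootFamily_of (rels := rels)
      (fun w hw => Or.inl (Or.inl hw)) (fun w hw => Or.inl (Or.inr hw))
    have hψ : ∀ (r : SLRel.Root n) (a : r.params K), PresentedGroup.toGroup hlift
        (PresentedGroup.mk rels (SLRel.X r a)) = SLRel.rootElt r a :=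
      fun r a => PresentedGroup.toGroup.of hlift
    have hker : (PresentedGroup.toGroup hlift).ker = Subgroup.closure
        {x | ∃ t₁ t₂ : Kˣ, x = SLRel.symb hn ord (SLRel.commFun n K) t₁ t₂} := by
      rw [hx.ker_eq hn (SLRel.closure_gen_eq_top rels) hψ]
      congr 1
      ext y
      constructor
      · rintro ⟨u, v, hu, hv, rfl⟩
        lift u to Kˣ using hu.isUnit
        lift v to Kˣ using hv.isUnit
        exact ⟨u, v, (SLRel.mk_symbol hn rels u v).symm⟩
      · rintro ⟨t₁, t₂, rfl⟩
        exact ⟨t₁, t₂, t₁.ne_zero, t₂.ne_zero, SLRel.mk_symbol hn rels t₁ t₂⟩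
    refine ⟨PresentedGroup.toGroup hlift, hψ, SLRel.IsRootFamily.surjective hψ, ?_, hker⟩
    rw [hker, Subgroup.closure_le]
    rintro _ ⟨t₁, t₂, rfl⟩
    exact SLRel.symb_mem_HTilde hn ord _ t₁ t₂
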